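/- Let $n,d$ be positive integers and let $U(n)\subset\mathbb C^{n\times n}$ carry the Riemannian metric induced by the real inner product $\operatorname{Re}\operatorname{tr}(ZW^*)$; it is a compact submanifold of dimension $n^2$. Let $\Sigma_n=\{a\in\mathbb C^n : a_k\neq 0 \text{ for } k=1,\dots,n\}$ and, for $a\in\Sigma_n$, let $$\Phi_a:U(n)\to\mathbb C,\qquad \Phi_a(z)=\sum_{k=1}^n a_k\,z_{1k}^d .$$ For a smooth function $\phi:M\to\mathbb C$ on a Riemannian manifold let $\tau(\phi)=\operatorname{div}(\nabla\phi)$ be the Laplace–Beltrami operator and $\kappa(\phi,\psi)=g(\nabla\phi,\nabla\psi)=\sum_{i,j} g^{ij}\,\partial_i\phi\,\partial_j\psi$ the conformality operator, where $\nabla\phi$ is the gradient in the complexified tangent bundle and $g$ is extended complex bilinearly. The function $\phi$ is an eigenfunction if there are $\lambda,\mu\in\mathbb C$ with $\tau(\phi)=\lambda\,\phi$ and $\kappa(\phi,\phi)=\mu\,\phi^2$ on $M$. Then for every $a\in\Sigma_n$: 1. $\Phi_a$ is an eigenfunction on $U(n)$. 2. The complex gradient $\nabla\Phi_a$ vanishes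 at no point of $U(n)$. 3. There is $\varepsilon>0$ such that $\Phi_a$ is submersive (its real differential $T_zU(n)\to\mathbb C$ is onto) at every $z\in U(n)$ with $|\Phi_a(z)|<\varepsilon$. In particular $0$ is not a critical value of $\Phi_a$. 4. If $n\ge 2$, the fibre $\Phi_a^{-1}(\{0\})$ is a non-empty compact minimal submanifold of $U(n)$ of codimension two. If $n=1$, the fibre is empty. This gives the family $\mathcal F_n=\{\Phi_a^{-1}(\{0\}) : a\in\Sigma_n\}$, parametrised by the non-empty open subset $\Sigma_n$ of $\mathbb C^n$ (so by $n$ complex parameters). Distinct $a\in\Sigma_n$ give distinct functions $\Phi_a$ on $U(n)$ and, for $n\ge2$, two parameters $a,b\in\Sigma_n$ give the same fibre if and only if $b=c\,a$ for some $c\in\mathbb C\setminus\{0\}$. -/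

import Mathlib

noncomputable section

namespace MinimalFibre

open scoped ContDiff Topology

/-! Riemannian geometry of embedded submanifolds of a finite-dimensional Euclidean space `E`.
Every submanifold carries the metric induced by the inner product of `E`. -/

section Submanifolds

variable {E : Type*} [NormedAddCommGroup E] [InnerProductSpace ℝ E]

/-- `ψ`, restricted to the open set `U ⊆ ℝᵐ`, is a smooth local parametrisation (the inverse of a
chart) of `M ⊆ E`: a smooth immersion and a homeomorphism onto a relatively open subset of `M`. -/
structure IsLocalParam (M : Set E) (m : ℕ) (U : Set (EuclideanSpace ℝ (Fin m)))
    (ψ : EuclideanSpace ℝ (Fin m) → E) : Prop where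
  isOpen_domain : IsOpen U
  contDiffOn : ContDiffOn ℝ ∞ ψ U
  immersion : ∀ x ∈ U, Function.Injective (fderiv ℝ ψ x)
  isEmbedding : Topology.IsEmbedding (U.domRestrict ψ)
  image_eq : ∃ V : Set E, IsOpen V ∧ ψ '' U = M ∩ V

/-- `M` is a smooth embedded submanifold of `E` of dimension `m`. -/
def IsSubmanifold (M : Set E) (m : ℕ) : Prop :=
  ∀ p ∈ M, ∃ (U : Set (EuclideanSpace ℝ (Fin m))) (ψ : EuclideanSpace ℝ (Fin m) → E),
    IsLocalParam M m U ψ ∧ p ∈ ψ '' U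

/-- The tangent space of `M` at `p`: velocities at `p` of smooth curves in `M`. -/
def tangentSpaceAt (M : Set E) (p : E) : Submodule ℝ E :=
  Submodule.span ℝ {v | ∃ γ : ℝ → E, ContDiffAt ℝ ∞ γ 0 ∧ (∀ᶠ t in 𝓝 0, γ t ∈ M) ∧
    γ 0 = p ∧ HasDerivAt γ v 0}

/-- The `i`-th partial derivative of a map defined on an open subset of `ℝᵐ`. -/
def partialDeriv {m : ℕ} {F : Type*} [NormedAddCommGroup F] [NormedSpace ℝ F] (i : Fin m)
    (h : EuclideanSpace ℝ (Fin m) → F) (x : EuclideanSpace ℝ (Fin m)) : F :=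
  fderiv ℝ h x (EuclideanSpace.single i 1)

/-- The matrix `(g_ij)` of the induced metric in the coordinates given by `ψ`. -/
def metricMatrix {m : ℕ} (ψ : EuclideanSpace ℝ (Fin m) → E) (x : EuclideanSpace ℝ (Fin m)) :
    Matrix (Fin m) (Fin m) ℝ :=
  Matrix.of fun i j => inner ℝ (partialDeriv i ψ x) (partialDeriv j ψ x)

/-- The inverse metric `g^ij`. -/
def invMetric {m : ℕ} (ψ : EuclideanSpace ℝ (Fin m) → E) (x : EuclideanSpace ℝ (Fin m)) :
    Matrix (Fin m) (Fin m) ℝ :=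
  (metricMatrix ψ x)⁻¹

/-- The Laplace-Beltrami operator (tension field) in the coordinates given by `ψ`, applied to the
complex-valued function with coordinate expression `h`:
`τ(h) = ∑ (1/√|g|) ∂_j (g^ij √|g| ∂_i h)`. -/
def laplaceBeltrami {m : ℕ} (ψ : EuclideanSpace ℝ (Fin m) → E)
    (h : EuclideanSpace ℝ (Fin m) → ℂ) (x : EuclideanSpace ℝ (Fin m)) : ℂ :=
  ∑ i, ∑ j, (1 / √(metricMatrix ψ x).det) •
    partialDeriv j (fun y => (invMetric ψ y i j * √(metricMatrix ψ y).det) • partialDeriv i h y) x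

/-- The conformality operator `κ(h, k) = ∑ g^ij ∂_i h ∂_j k` in the coordinates given by `ψ`. -/
def conformality {m : ℕ} (ψ : EuclideanSpace ℝ (Fin m) → E)
    (h k : EuclideanSpace ℝ (Fin m) → ℂ) (x : EuclideanSpace ℝ (Fin m)) : ℂ :=
  ∑ i, ∑ j, (invMetric ψ x i j : ℂ) * partialDeriv i h x * partialDeriv j k x

/-- The gradient, a section of the complexified tangent bundle; its components in the coordinate
frame given by `ψ` are `(∇h)^j = ∑ g^ij ∂_i h`. -/
def gradient {m : ℕ} (ψ : EuclideanSpace ℝ (Fin m) → E)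
    (h : EuclideanSpace ℝ (Fin m) → ℂ) (x : EuclideanSpace ℝ (Fin m)) : Fin m → ℂ :=
  fun j => ∑ i, (invMetric ψ x i j : ℂ) * partialDeriv i h x

/-- The restriction of `f` to the `m`-dimensional submanifold `M` is an eigenfunction: it is smooth,
and eigen for both the Laplace-Beltrami operator and the conformality operator of `M`.  Only the
values of `f` on `M` matter. -/
def IsEigenfunction (M : Set E) (m : ℕ) (f : E → ℂ) : Prop :=
  (∀ U ψ, IsLocalParam M m U ψ → ContDiffOn ℝ ∞ (f ∘ ψ) U) ∧
  ∃ lam mu : ℂ, ∀ U ψ, IsLocalParam M m U ψ → ∀ x ∈ U,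
    laplaceBeltrami ψ (f ∘ ψ) x = lam * f (ψ x) ∧
    conformality ψ (f ∘ ψ) (f ∘ ψ) x = mu * f (ψ x) ^ 2

/-- The (complex) gradient of `f` on `M` does not vanish at the point `p` of `M`. -/
def GradientNeZeroAt (M : Set E) (m : ℕ) (f : E → ℂ) (p : E) : Prop :=
  ∀ U ψ, IsLocalParam M m U ψ → ∀ x ∈ U, ψ x = p → gradient ψ (f ∘ ψ) x ≠ 0

/-- The restriction of `f` to `M` is submersive at the point `p` of `M`: its real differential
`T_p M → ℂ` is onto. -/
def IsSubmersiveAt (M : Set E) (m : ℕ) (f : E → ℂ) (p : E) : Prop :=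
  ∀ U ψ, IsLocalParam M m U ψ → ∀ x ∈ U, ψ x = p →
    Function.Surjective (fderiv ℝ (f ∘ ψ) x)

variable [FiniteDimensional ℝ E]

/-- The normal space at `p` of the submanifold `K` inside the submanifold `M`. -/
def normalSpaceAt (K M : Set E) (p : E) : Submodule ℝ E :=
  tangentSpaceAt M p ⊓ (tangentSpaceAt K p)ᗮ

/-- The value `B(∂_i, ∂_j)` of the second fundamental form of `K` in `M`, in the coordinates of `K`
given by `ψ`.  The Levi-Civita connection of `M` is the tangential part of the derivative in `E`, so
that `B(∂_i, ∂_j) = (∇^M_{∂_i} ∂_j)^⊥` is the component of `∂_i ∂_j ψ` in the normal space of `K`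
in `M`. -/
def secondFundamentalForm (K M : Set E) {k : ℕ} (ψ : EuclideanSpace ℝ (Fin k) → E)
    (x : EuclideanSpace ℝ (Fin k)) (i j : Fin k) : E :=
  (normalSpaceAt K M (ψ x)).starProjection (partialDeriv i (partialDeriv j ψ) x)

/-- The mean curvature vector of `K` in `M`. -/
def meanCurvature (K M : Set E) {k : ℕ} (ψ : EuclideanSpace ℝ (Fin k) → E)
    (x : EuclideanSpace ℝ (Fin k)) : E :=
  (1 / (k : ℝ)) • ∑ i, ∑ j, invMetric ψ x i j • secondFundamentalForm K M ψ x i j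

/-- `K` is a minimal submanifold of codimension `c` of the submanifold `M`. -/
def IsMinimalSubmanifold (K M : Set E) (c : ℕ) : Prop :=
  K ⊆ M ∧ ∃ k : ℕ, IsSubmanifold M (k + c) ∧ IsSubmanifold K k ∧
    ∀ U ψ, IsLocalParam K k U ψ → ∀ x ∈ U, meanCurvature K M ψ x = 0

end Submanifolds

section UnitaryGroup

/-- The space of complex `n × n` matrices as a real Euclidean space, with the real inner product
`Re tr (Z W*)`. -/
abbrev MatrixSpace (n : ℕ) : Type := EuclideanSpace ℂ (Fin n × Fin n)

/-- The matrix given by a point of `MatrixSpace n`. -/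
def toMatrix {n : ℕ} (z : MatrixSpace n) : Matrix (Fin n) (Fin n) ℂ :=
  Matrix.of fun i j => z (i, j)

/-- The point of `MatrixSpace n` given by a matrix. -/
def ofMatrix {n : ℕ} (A : Matrix (Fin n) (Fin n) ℂ) : MatrixSpace n :=
  WithLp.toLp 2 fun p => A p.1 p.2

/-- The unitary group, as a subset of the Euclidean space of matrices. -/
def unitary (n : ℕ) : Set (MatrixSpace n) :=
  {z | toMatrix z ∈ Matrix.unitaryGroup (Fin n) ℂ}

theorem inner_ofMatrix {n : ℕ} (Z W : Matrix (Fin n) (Fin n) ℂ) :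
    inner ℝ (ofMatrix Z) (ofMatrix W) = (Matrix.trace (Z * W.conjTranspose)).re := by
  simp [ofMatrix, PiLp.inner_apply, Matrix.trace, Matrix.mul_apply, Fintype.sum_prod_type,
    Complex.inner, mul_comm]

/-- On the unitary group the induced metric is the left-invariant metric given by the inner product
`Re tr (Z W*)` on the Lie algebra. -/
theorem inner_left_translate {n : ℕ} (z : MatrixSpace n) (hz : z ∈ unitary n)
    (Z W : Matrix (Fin n) (Fin n) ℂ) :
    inner ℝ (ofMatrix (toMatrix z * Z)) (ofMatrix (toMatrix z * W)) =
      (Matrix.trace (Z * W.conjTranspose)).re := by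
  have h : (toMatrix z).conjTranspose * toMatrix z = 1 := Matrix.mem_unitaryGroup_iff'.1 hz
  rw [inner_ofMatrix, Matrix.conjTranspose_mul, Matrix.trace_mul_comm]
  rw [show W.conjTranspose * (toMatrix z).conjTranspose * (toMatrix z * Z) =
    W.conjTranspose * ((toMatrix z).conjTranspose * toMatrix z) * Z by simp only [Matrix.mul_assoc],
    h, Matrix.mul_one, Matrix.trace_mul_comm]

/-- The parameter set `Σ_n` of all `a ∈ ℂⁿ` with `a_k ≠ 0` for every `k`. -/
def paramSet (n : ℕ) : Set (Fin n → ℂ) := {a | ∀ k, a k ≠ 0}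

/-- `Φ_a(z) = ∑ a_k z_{1k}^d`; the first row has index `0`. -/
def Phi {n : ℕ} [NeZero n] (d : ℕ) (a : Fin n → ℂ) (z : MatrixSpace n) : ℂ :=
  ∑ k, a k * toMatrix z 0 k ^ d

/-- The fibre over `0` of `Φ_a : U(n) → ℂ`. -/
def zeroFibre {n : ℕ} [NeZero n] (d : ℕ) (a : Fin n → ℂ) : Set (MatrixSpace n) :=
  {z | z ∈ unitary n ∧ Phi d a z = 0}

end UnitaryGroup

end MinimalFibre

end

/-! Everything is computed in the flat matrix space. In coordinates `ψ`, the operator `w ↦ ∑ g^ij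
⟨∂_j ψ, w⟩ ∂_i ψ` is the orthogonal projection onto the tangent space
(`IsLocalParam.sum_invMetric_smul`), so an explicit projection gives every metric trace. The
Laplace-Beltrami operator of a restricted function is the trace of its ambient Hessian plus its
derivative along the tension vector of the inclusion, which is normal.

`U(n)` is a regular level set of `z ↦ 2zz*` with Hermitian values, and its tangential projection is
`w ↦ (w - z w* z)/2`. Hence `κ(z_ij, z_kl) = -z_il z_kj`, and the tension vector is `-n z`. Since
`Φ_a` is homogeneous of degree `d` in the first row, Euler's identity gives `τ(Φ_a) = -d(d - 1 + n)
Φ_a` and `κ(Φ_a, Φ_a) = -d² Φ_a²`.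

Let `c_k = ∂Φ_a/∂z_1k`. Then `∑ c_k z_1k = d Φ_a`, and the differential on `U(n)` is onto as soon as
`|∑ c_k z_1k|² < ∑ |c_k|²` (`exists_tangent_of_normSq_lt`). The first row is a unit vector, so some
`|z_1k|` is at least `1/n`. This bounds `∑ |c_k|²` below, uniformly, and yields `ε`. Away from the
zero fibre the tangent vector `i z` already has derivative `i d Φ_a ≠ 0`.

On the zero fibre the tangent space loses the span of two normals `ν_1`, `ν_i` whose first rows are
`c̄/2` and `i c̄/2`. In complex bilinear first-row traces they cancel, so the trace of the Hessian
of `Φ_a` remains a multiple of `Φ_a` and vanishes. Let `L = ∑ g^ij ∂_i ∂_j ψ`, and let `A` be the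
Hermitian trace of the first derivatives. The first row of `A` is `2(n - 1) e_1`. Thus `L + A z/2`
is tangent to the fibre while `A z` is normal to `U(n)`, so `L` has no component in the normal space
of the fibre in `U(n)`.

Taking `d`-th roots and normalising realises any nonzero `w` as the direction of `(z_1k^d)`; then
`Φ_b(z) = t ∑ b_k w_k` with `t ≠ 0` for all `b` (`exists_unitary_Phi_eq`). Non-emptiness and both
uniqueness statements become linear algebra. -/

noncomputable section

namespace MinimalFibre

open scoped ContDiff Topology Matrix

/-! ### Gram matrices and orthogonal projection -/

section Gram

variable {E : Type*} [NormedAddCommGroup E] [InnerProductSpace ℝ E]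
  {ι : Type*} [Fintype ι] [DecidableEq ι] {v : ι → E}

theorem isUnit_det_gram (hv : LinearIndependent ℝ v) : IsUnit (Matrix.gram ℝ v).det :=
  isUnit_iff_ne_zero.2 (Matrix.det_gram_ne_zero_iff_linearIndependent.2 hv)

/-- The inverse Gram matrix of a linearly independent family yields the orthogonal projection onto
its span. -/
theorem sum_inv_gram_smul (hv : LinearIndependent ℝ v) {w t : E}
    (ht : t ∈ Submodule.span ℝ (Set.range v)) (hw : ∀ i, inner ℝ (v i) (w - t) = 0) :
    ∑ i, ∑ j, ((Matrix.gram ℝ v)⁻¹ i j * inner ℝ (v j) w) • v i = t := by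
  obtain ⟨c, rfl⟩ := (Submodule.mem_span_range_iff_exists_fun ℝ).1 ht
  have h1 : ∀ j, inner ℝ (v j) w = (Matrix.gram ℝ v).mulVec c j := by
    intro j
    have := hw j
    rw [inner_sub_right, sub_eq_zero] at this
    rw [this, inner_sum]
    simp [Matrix.mulVec, dotProduct, Matrix.gram_apply, inner_smul_right, mul_comm]
  refine Finset.sum_congr rfl fun i _ => ?_
  rw [← Finset.sum_smul]
  congr 1
  have h2 : (Matrix.gram ℝ v)⁻¹.mulVec ((Matrix.gram ℝ v).mulVec c) i = c i := by
    rw [Matrix.mulVec_mulVec, Matrix.nonsing_inv_mul _ (isUnit_det_gram hv), Matrix.one_mulVec]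
  rw [← h2]
  simp [Matrix.mulVec, dotProduct, h1]

end Gram

/-! ### Differentiating determinants and inverse matrices -/

section Determinant

variable {V : Type*} [NormedAddCommGroup V] [NormedSpace ℝ V]
  {ι : Type*} [Fintype ι] [DecidableEq ι]

/-- Jacobi's formula for the derivative of the determinant. -/
theorem hasFDerivAt_det {A : V → Matrix ι ι ℝ} {A' : ι → ι → V →L[ℝ] ℝ} {x : V}
    (h : ∀ i j, HasFDerivAt (fun y => A y i j) (A' i j) x) :
    HasFDerivAt (fun y => (A y).det) (∑ i, ∑ k, (A x).adjugate i k • A' k i) x := by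
  have h1 : HasFDerivAt (fun y => ∑ σ : Equiv.Perm ι, ((σ.sign : ℤ) : ℝ) * ∏ i, A y (σ i) i)
      (∑ σ : Equiv.Perm ι, ((σ.sign : ℤ) : ℝ) •
        ∑ i, (∏ j ∈ Finset.univ.erase i, A x (σ j) j) • A' (σ i) i) x := by
    refine HasFDerivAt.fun_sum fun σ _ => ?_
    exact (HasFDerivAt.finsetProd (fun i _ => h (σ i) i)).const_mul _
  simp only [← Matrix.det_apply'] at h1
  refine h1.congr_fderiv ?_
  ext u
  simp only [sum_apply, smul_apply, smul_eq_mul,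
    Finset.mul_sum]
  rw [Finset.sum_comm]
  refine Finset.sum_congr rfl fun i _ => ?_
  -- By Cramer's rule this sum is the determinant with column `i` replaced by its derivative, which
  -- matches the `i`-th term of the Leibniz expansion.
  have h2 : ∑ k, (A x).adjugate i k * A' k i u =
      ((A x).updateCol i fun k => A' k i u).det := by
    rw [← Matrix.cramer_apply, Matrix.cramer_eq_adjugate_mulVec]
    rfl
  rw [h2, Matrix.det_apply']
  refine Finset.sum_congr rfl fun σ _ => ?_
  congr 1
  rw [← Finset.mul_prod_erase Finset.univ _ (Finset.mem_univ i), Matrix.updateCol_self, mul_comm]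
  congr 1
  refine Finset.prod_congr rfl fun j hj => ?_
  rw [Matrix.updateCol_ne (Finset.ne_of_mem_erase hj)]

theorem differentiableAt_det {A : V → Matrix ι ι ℝ} {x : V}
    (h : ∀ i j, DifferentiableAt ℝ (fun y => A y i j) x) :
    DifferentiableAt ℝ (fun y => (A y).det) x :=
  (hasFDerivAt_det fun i j => (h i j).hasFDerivAt).differentiableAt

theorem differentiableAt_inv_apply {A : V → Matrix ι ι ℝ} {x : V}
    (h : ∀ i j, DifferentiableAt ℝ (fun y => A y i j) x) (h0 : (A x).det ≠ 0) (i j : ι) :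
    DifferentiableAt ℝ (fun y => (A y)⁻¹ i j) x := by
  have h1 : DifferentiableAt ℝ (fun y => (A y).adjugate i j) x := by
    simp only [Matrix.adjugate_apply]
    refine differentiableAt_det fun k l => ?_
    by_cases hk : k = j
    · subst hk; simp
    · simpa [Matrix.updateRow_ne hk] using h k l
  have h2 : ∀ y, (A y)⁻¹ i j = ((A y).det)⁻¹ * (A y).adjugate i j := by
    intro y; simp [Matrix.inv_def]
  simp only [h2]
  exact ((differentiableAt_det h).fun_inv h0).mul h1

end Determinant

/-! ### Calculus in a local parametrisation -/

section LocalParam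

variable {E : Type*} [NormedAddCommGroup E] [InnerProductSpace ℝ E]
  {F : Type*} [NormedAddCommGroup F] [NormedSpace ℝ F]
  {M : Set E} {m : ℕ} {U : Set (EuclideanSpace ℝ (Fin m))} {ψ : EuclideanSpace ℝ (Fin m) → E}
  {x : EuclideanSpace ℝ (Fin m)}

theorem IsLocalParam.contDiffAt (h : IsLocalParam M m U ψ) (hx : x ∈ U) : ContDiffAt ℝ ∞ ψ x :=
  h.contDiffOn.contDiffAt (h.isOpen_domain.mem_nhds hx)

theorem IsLocalParam.mem (h : IsLocalParam M m U ψ) (hx : x ∈ U) : ψ x ∈ M := by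
  obtain ⟨V, -, hV⟩ := h.image_eq
  exact (hV ▸ Set.mem_image_of_mem ψ hx : ψ x ∈ M ∩ V).1

theorem IsLocalParam.eventually_mem (h : IsLocalParam M m U ψ) (hx : x ∈ U) :
    ∀ᶠ y in 𝓝 x, ψ y ∈ M :=
  (h.isOpen_domain.eventually_mem hx).mono fun _ hy => h.mem hy

theorem IsLocalParam.linearIndependent (h : IsLocalParam M m U ψ) (hx : x ∈ U) :
    LinearIndependent ℝ fun i => partialDeriv i ψ x := by
  have h1 := (EuclideanSpace.basisFun (Fin m) ℝ).toBasis.linearIndependent.map'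
    (fderiv ℝ ψ x).toLinearMap (LinearMap.ker_eq_bot.2 (h.immersion x hx))
  have h2 : (fun i => partialDeriv i ψ x) =
      (fderiv ℝ ψ x).toLinearMap ∘ (EuclideanSpace.basisFun (Fin m) ℝ).toBasis := by
    ext1 i
    simp [partialDeriv]
  rwa [h2]

theorem fderiv_apply_eq_sum (h : EuclideanSpace ℝ (Fin m) → F) (u : EuclideanSpace ℝ (Fin m)) :
    fderiv ℝ h x u = ∑ i, u i • partialDeriv i h x := by
  conv_lhs => rw [← (EuclideanSpace.basisFun (Fin m) ℝ).sum_repr u]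
  simp [partialDeriv]

theorem span_partialDeriv (h : EuclideanSpace ℝ (Fin m) → F) :
    Submodule.span ℝ (Set.range fun i => partialDeriv i h x) =
      LinearMap.range (fderiv ℝ h x).toLinearMap := by
  apply le_antisymm
  · rw [Submodule.span_le]
    rintro _ ⟨i, rfl⟩
    exact ⟨_, rfl⟩
  · rintro _ ⟨u, rfl⟩
    rw [ContinuousLinearMap.coe_coe, fderiv_apply_eq_sum]
    exact Submodule.sum_mem _ fun i _ => Submodule.smul_mem _ _ (Submodule.subset_span ⟨i, rfl⟩)

theorem IsLocalParam.det_pos (h : IsLocalParam M m U ψ) (hx : x ∈ U) :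
    0 < (metricMatrix ψ x).det :=
  (Matrix.posDef_gram_of_linearIndependent (h.linearIndependent hx)).det_pos

theorem invMetric_symm (ψ : EuclideanSpace ℝ (Fin m) → E) (x : EuclideanSpace ℝ (Fin m))
    (i j : Fin m) : invMetric ψ x i j = invMetric ψ x j i := by
  have h1 : (metricMatrix ψ x).transpose = metricMatrix ψ x := by
    ext i j
    exact real_inner_comm _ _
  rw [invMetric, ← Matrix.transpose_apply (metricMatrix ψ x)⁻¹ j i, Matrix.transpose_nonsing_inv,
    h1]

theorem IsLocalParam.sum_invMetric_mul (h : IsLocalParam M m U ψ) (hx : x ∈ U) (j k : Fin m) :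
    ∑ i, invMetric ψ x i j * metricMatrix ψ x i k = if j = k then 1 else 0 := by
  have h1 := Matrix.nonsing_inv_mul _ (isUnit_iff_ne_zero.2 (h.det_pos hx).ne')
  have h2 := congrFun (congrFun h1 j) k
  rw [Matrix.mul_apply, Matrix.one_apply] at h2
  rw [← h2]
  exact Finset.sum_congr rfl fun i _ => by rw [invMetric_symm]; rfl

/-- The tangential projection in coordinates. -/
theorem IsLocalParam.sum_invMetric_smul (h : IsLocalParam M m U ψ) (hx : x ∈ U) {w t : E}
    (ht : t ∈ LinearMap.range (fderiv ℝ ψ x).toLinearMap)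
    (hw : ∀ u, inner ℝ (fderiv ℝ ψ x u) (w - t) = 0) :
    ∑ i, ∑ j, (invMetric ψ x i j * inner ℝ (partialDeriv j ψ x) w) • partialDeriv i ψ x = t :=
  sum_inv_gram_smul (h.linearIndependent hx) (span_partialDeriv ψ ▸ ht) fun _ => hw _

theorem contDiffAt_partialDeriv {h : EuclideanSpace ℝ (Fin m) → F} (hh : ContDiffAt ℝ ∞ h x)
    (i : Fin m) : ContDiffAt ℝ ∞ (partialDeriv i h) x :=
  (hh.fderiv_right (m := ∞) (by simp)).clm_apply contDiffAt_const

theorem differentiableAt_partialDeriv {h : EuclideanSpace ℝ (Fin m) → F}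
    (hh : ContDiffAt ℝ ∞ h x) (i : Fin m) : DifferentiableAt ℝ (partialDeriv i h) x :=
  (contDiffAt_partialDeriv hh i).differentiableAt (by simp)

theorem partialDeriv_comm {h : EuclideanSpace ℝ (Fin m) → F} (hh : ContDiffAt ℝ ∞ h x)
    (i j : Fin m) :
    partialDeriv i (partialDeriv j h) x = partialDeriv j (partialDeriv i h) x := by
  have h1 : DifferentiableAt ℝ (fderiv ℝ h) x :=
    (hh.fderiv_right (m := ∞) (by simp)).differentiableAt (by simp)
  have h2 := hh.isSymmSndFDerivAt (by
    rw [minSmoothness_of_isRCLikeNormedField]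
    exact WithTop.coe_le_coe.2 (le_top : (2 : ℕ∞) ≤ ⊤))
  have h3 : ∀ i j, partialDeriv i (partialDeriv j h) x =
      fderiv ℝ (fderiv ℝ h) x (EuclideanSpace.single i 1) (EuclideanSpace.single j 1) := by
    intro i j
    change fderiv ℝ (fun y => fderiv ℝ h y (EuclideanSpace.single j 1)) x _ = _
    rw [fderiv_clm_apply h1 (by fun_prop)]
    simp
  rw [h3, h3, h2]

theorem partialDeriv_comp {f : E → F} (hf : DifferentiableAt ℝ f (ψ x))
    (hψ : DifferentiableAt ℝ ψ x) (i : Fin m) :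
    partialDeriv i (f ∘ ψ) x = fderiv ℝ f (ψ x) (partialDeriv i ψ x) := by
  rw [partialDeriv, fderiv_comp x hf hψ]
  rfl

theorem partialDeriv_partialDeriv_comp {f : E → F} (hf : ContDiff ℝ ∞ f)
    (hψ : ContDiffAt ℝ ∞ ψ x) (i j : Fin m) :
    partialDeriv j (partialDeriv i (f ∘ ψ)) x =
      fderiv ℝ (fderiv ℝ f) (ψ x) (partialDeriv j ψ x) (partialDeriv i ψ x) +
        fderiv ℝ f (ψ x) (partialDeriv j (partialDeriv i ψ) x) := by
  have h1 : partialDeriv i (f ∘ ψ) =ᶠ[𝓝 x] fun y => fderiv ℝ f (ψ y) (partialDeriv i ψ y) := by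
    -- The first-order chain rule is needed on a neighbourhood, since it is differentiated again at
    -- `x`.
    have : ∀ᶠ y in 𝓝 x, ContDiffAt ℝ 1 ψ y :=
      (hψ.of_le (by simp)).eventually (by simp)
    filter_upwards [this] with y hy
    exact partialDeriv_comp ((hf.differentiable (by simp)) _) (hy.differentiableAt (by simp)) i
  have hψ' : DifferentiableAt ℝ ψ x := hψ.differentiableAt (by simp)
  have h2 : DifferentiableAt ℝ (fderiv ℝ f) (ψ x) :=
    ((hf.fderiv_right (m := ∞) (by simp)).differentiable (by simp)) _
  rw [partialDeriv, h1.fderiv_eq]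
  have h3 : HasFDerivAt (fun y => fderiv ℝ f (ψ y))
      ((fderiv ℝ (fderiv ℝ f) (ψ x)).comp (fderiv ℝ ψ x)) x :=
    h2.hasFDerivAt.comp x hψ'.hasFDerivAt
  rw [(h3.clm_apply (differentiableAt_partialDeriv hψ i).hasFDerivAt).fderiv]
  simp [partialDeriv, add_comm]

theorem partialDeriv_eq_zero_of_eventually_const {h : EuclideanSpace ℝ (Fin m) → F} {c : F}
    (hh : ∀ᶠ y in 𝓝 x, h y = c) (i : Fin m) : ∀ᶠ y in 𝓝 x, partialDeriv i h y = 0 := by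
  filter_upwards [hh.eventually_nhds] with y hy
  have : h =ᶠ[𝓝 y] fun _ => c := hy
  rw [partialDeriv, this.fderiv_eq]
  simp

/-- Differentiating twice an equation that holds on a submanifold. -/
theorem IsLocalParam.sum_fderiv_fderiv_add (h : IsLocalParam M m U ψ) (hx : x ∈ U) {f : E → F}
    (hf : ContDiff ℝ ∞ f) {c : F} (hc : ∀ p ∈ M, f p = c) (a : Fin m → Fin m → ℝ) :
    ∑ i, ∑ j, a i j • fderiv ℝ (fderiv ℝ f) (ψ x) (partialDeriv i ψ x) (partialDeriv j ψ x) +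
      fderiv ℝ f (ψ x) (∑ i, ∑ j, a i j • partialDeriv i (partialDeriv j ψ) x) = 0 := by
  have h0 : ∀ᶠ y in 𝓝 x, (f ∘ ψ) y = c := (h.eventually_mem hx).mono fun y hy => hc _ hy
  have h1 : ∀ i j, fderiv ℝ (fderiv ℝ f) (ψ x) (partialDeriv i ψ x) (partialDeriv j ψ x) +
        fderiv ℝ f (ψ x) (partialDeriv i (partialDeriv j ψ) x) = 0 := by
    intro i j
    rw [← partialDeriv_partialDeriv_comp hf (h.contDiffAt hx)]
    exact (partialDeriv_eq_zero_of_eventually_const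
      (partialDeriv_eq_zero_of_eventually_const h0 j) i).self_of_nhds
  simp only [map_sum, map_smul, ← Finset.sum_add_distrib, ← smul_add, h1, smul_zero,
    Finset.sum_const_zero]

theorem IsLocalParam.range_fderiv_le_ker (h : IsLocalParam M m U ψ) (hx : x ∈ U) {f : E → F}
    (hf : ContDiff ℝ ∞ f) {c : F} (hc : ∀ p ∈ M, f p = c) :
    LinearMap.range (fderiv ℝ ψ x).toLinearMap ≤ LinearMap.ker (fderiv ℝ f (ψ x)).toLinearMap := by
  have h0 : f ∘ ψ =ᶠ[𝓝 x] fun _ => c := (h.eventually_mem hx).mono fun y hy => hc _ hy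
  rintro _ ⟨u, rfl⟩
  have h1 := fderiv_comp x ((hf.differentiable (by simp)) _)
    ((h.contDiffAt hx).differentiableAt (by simp))
  rw [h0.fderiv_eq] at h1
  simpa using (DFunLike.congr_fun h1 u).symm

theorem IsLocalParam.finrank_range (h : IsLocalParam M m U ψ) (hx : x ∈ U) :
    Module.finrank ℝ (LinearMap.range (fderiv ℝ ψ x).toLinearMap) = m := by
  rw [LinearMap.finrank_range_of_inj (h.immersion x hx), finrank_euclideanSpace_fin]

/-- The image of the differential of a parametrisation of a regular level set. -/
theorem IsLocalParam.range_fderiv_eq_ker [FiniteDimensional ℝ E] (h : IsLocalParam M m U ψ)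
    (hx : x ∈ U) {f : E → F} (hf : ContDiff ℝ ∞ f) {c : F} (hc : ∀ p ∈ M, f p = c)
    (hs : Function.Surjective (fderiv ℝ f (ψ x)))
    (hm : Module.finrank ℝ E = m + Module.finrank ℝ F) :
    LinearMap.range (fderiv ℝ ψ x).toLinearMap = LinearMap.ker (fderiv ℝ f (ψ x)).toLinearMap := by
  apply Submodule.eq_of_le_of_finrank_eq (h.range_fderiv_le_ker hx hf hc)
  rw [h.finrank_range hx]
  have h1 := LinearMap.finrank_range_add_finrank_ker (fderiv ℝ f (ψ x)).toLinearMap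
  rw [LinearMap.range_eq_top.2 hs, finrank_top] at h1
  omega

end LocalParam

/-! ### Regular level sets are submanifolds -/

section RegularLevelSet

variable {E : Type*} [NormedAddCommGroup E] [InnerProductSpace ℝ E] [FiniteDimensional ℝ E]
  {F : Type*} [NormedAddCommGroup F] [NormedSpace ℝ F] [FiniteDimensional ℝ F]

/-- If `f` is submersive at `p`, it is completed to a linear isomorphism by a linear map. -/
theorem exists_complement_equiv {A : E →L[ℝ] F} (hA : Function.Surjective A) {m : ℕ}
    (hm : Module.finrank ℝ E = m + Module.finrank ℝ F) :
    ∃ (π : E →L[ℝ] EuclideanSpace ℝ (Fin m)) (e : E ≃L[ℝ] F × EuclideanSpace ℝ (Fin m)),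
      (e : E →L[ℝ] F × EuclideanSpace ℝ (Fin m)) = A.prod π := by
  set K := LinearMap.ker A.toLinearMap with hK
  have hfin : Module.finrank ℝ K = Module.finrank ℝ (EuclideanSpace ℝ (Fin m)) := by
    have h1 := LinearMap.finrank_range_add_finrank_ker A.toLinearMap
    rw [LinearMap.range_eq_top.2 hA, finrank_top, ← hK] at h1
    rw [finrank_euclideanSpace_fin]
    omega
  let e₀ : K ≃L[ℝ] EuclideanSpace ℝ (Fin m) := ContinuousLinearEquiv.ofFinrankEq hfin
  let π : E →L[ℝ] EuclideanSpace ℝ (Fin m) :=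
    (e₀ : K →L[ℝ] EuclideanSpace ℝ (Fin m)).comp K.orthogonalProjectionOnto
  have hinj : Function.Injective (A.prod π).toLinearMap := by
    rw [← LinearMap.ker_eq_bot, LinearMap.ker_eq_bot']
    intro u hu
    have h1 : A u = 0 := congrArg Prod.fst hu
    have h2 : π u = 0 := congrArg Prod.snd hu
    have h3 : K.orthogonalProjectionOnto u = 0 := by simpa [π] using h2
    have h4 := Submodule.orthogonalProjectionOnto_mem_subspace_eq_self (K := K) ⟨u, h1⟩
    rw [h3] at h4
    exact (congrArg Subtype.val h4).symm
  have hdim : Module.finrank ℝ E = Module.finrank ℝ (F × EuclideanSpace ℝ (Fin m)) := by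
    rw [Module.finrank_prod, finrank_euclideanSpace_fin, hm, add_comm]
  refine ⟨π, (LinearEquiv.ofInjectiveOfFinrankEq _ hinj hdim).toContinuousLinearEquiv, ?_⟩
  ext u <;> rfl

/-- A regular level set is an embedded submanifold. -/
theorem isSubmanifold_of_regular {f : E → F} (hf : ContDiff ℝ ∞ f) {c : F} {M : Set E}
    (hM : ∀ p, p ∈ M ↔ f p = c) (hs : ∀ p ∈ M, Function.Surjective (fderiv ℝ f p)) {m : ℕ}
    (hm : Module.finrank ℝ E = m + Module.finrank ℝ F) : IsSubmanifold M m := by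
  intro p hp
  obtain ⟨π, e, he⟩ := exists_complement_equiv (hs p hp) hm
  -- The inverse function theorem straightens `f` with `π` as the remaining coordinates. Then `π` is
  -- a left inverse of `ψ` on `U`, which gives both injectivity of the differential and the
  -- embedding property.
  let Θ : E → F × EuclideanSpace ℝ (Fin m) := fun z => (f z, π z)
  have hΘ : ContDiff ℝ ∞ Θ := hf.prodMk π.contDiff
  have hΘ' : ∀ z, HasFDerivAt Θ ((fderiv ℝ f z).prod π) z := fun z =>
    ((hf.differentiable (by simp)) z).hasFDerivAt.prodMk π.hasFDerivAt
  -- Restricting to points with invertible differential makes the local inverse smooth on its whole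
  -- domain, not only at the image of `p`.
  let S : Set E := {z | fderiv ℝ Θ z ∈
    Set.range ((↑) : (E ≃L[ℝ] F × EuclideanSpace ℝ (Fin m)) → E →L[ℝ] _)}
  have hS : IsOpen S :=
    ContinuousLinearEquiv.isOpen.preimage (hΘ.continuous_fderiv (by simp))
  have hpS : p ∈ S := ⟨e, by rw [he, (hΘ' p).fderiv]⟩
  let T := (hΘ.contDiffAt.toOpenPartialHomeomorph Θ (he ▸ hΘ' p : HasFDerivAt Θ (e : E →L[ℝ] _) p)
    (by simp)).restrOpen S hS
  have hT : ∀ z, T z = Θ z := fun z => rfl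
  have hTS : ∀ z ∈ T.source, z ∈ S := fun z hz => hz.2
  have hpT : p ∈ T.source := ⟨hΘ.contDiffAt.mem_toOpenPartialHomeomorph_source _ _, hpS⟩
  let ψ : EuclideanSpace ℝ (Fin m) → E := fun x => T.symm (c, x)
  let U : Set (EuclideanSpace ℝ (Fin m)) := {x | (c, x) ∈ T.target}
  have hU : IsOpen U := T.open_target.preimage (by fun_prop)
  have hψT : ∀ x ∈ U, Θ (ψ x) = (c, x) := fun x hx => T.right_inv hx
  have hsmooth : ∀ x ∈ U, ContDiffAt ℝ ∞ ψ x := by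
    intro x hx
    obtain ⟨e', he'⟩ := hTS _ (T.map_target hx)
    have h1 : ContDiffAt ℝ ∞ T.symm (c, x) := by
      refine T.contDiffAt_symm hx (f₀' := e') ?_ hΘ.contDiffAt
      rw [he']
      exact ((hΘ.differentiable (by simp)) _).hasFDerivAt
    exact h1.comp x (contDiff_prodMk_right c).contDiffAt
  have himage : ψ '' U = M ∩ T.source := by
    ext z
    constructor
    · rintro ⟨x, hx, rfl⟩
      exact ⟨(hM _).2 (congrArg Prod.fst (hψT x hx)), T.map_target hx⟩
    · rintro ⟨hz, hz'⟩
      have h1 : T z = (c, π z) := by rw [hT, ← (hM z).1 hz]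
      have h2 : (c, π z) ∈ T.target := h1 ▸ T.map_source hz'
      exact ⟨π z, h2, by simp only [ψ]; rw [← h1, T.left_inv hz']⟩
  refine ⟨U, ψ, ⟨hU, fun x hx => (hsmooth x hx).contDiffWithinAt, ?_, ?_, T.source, T.open_source,
    himage⟩, himage ▸ ⟨hp, hpT⟩⟩
  · intro x hx
    have h1 : HasFDerivAt (fun y => π (ψ y)) (π.comp (fderiv ℝ ψ x)) x :=
      π.hasFDerivAt.comp x ((hsmooth x hx).differentiableAt (by simp)).hasFDerivAt
    have h2 : (fun y => π (ψ y)) =ᶠ[𝓝 x] id :=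
      (hU.eventually_mem hx).mono fun y hy => congrArg Prod.snd (hψT y hy)
    have h3 := h1.unique ((hasFDerivAt_id x).congr_of_eventuallyEq h2)
    exact Function.LeftInverse.injective (g := π) fun u => DFunLike.congr_fun h3 u
  · refine Topology.IsEmbedding.of_comp (g := π) ?_ π.continuous ?_
    · exact continuousOn_iff_continuous_domRestrict.1 fun x hx =>
        (hsmooth x hx).continuousAt.continuousWithinAt
    · have h1 : π ∘ U.domRestrict ψ = Subtype.val := by
        ext1 x
        exact congrArg Prod.snd (hψT x x.2)
      rw [h1]
      exact Topology.IsEmbedding.subtypeVal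

end RegularLevelSet

/-! ### The Laplace-Beltrami operator of a restricted function -/

section Laplacian

variable {E : Type*} [NormedAddCommGroup E] [InnerProductSpace ℝ E]
  {M : Set E} {m : ℕ} {U : Set (EuclideanSpace ℝ (Fin m))} {ψ : EuclideanSpace ℝ (Fin m) → E}
  {x : EuclideanSpace ℝ (Fin m)}

/-- The coefficients `∑_j (1/√|g|) ∂_j (g^ij √|g|)` of the first-order part of the Laplace-Beltrami
operator. -/
def laplaceCoeff (ψ : EuclideanSpace ℝ (Fin m) → E) (x : EuclideanSpace ℝ (Fin m)) (i : Fin m) :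
    ℝ :=
  ∑ j, (1 / √(metricMatrix ψ x).det) *
    partialDeriv j (fun y => invMetric ψ y i j * √(metricMatrix ψ y).det) x

/-- The Laplace-Beltrami operator applied to the inclusion of the submanifold. -/
def tensionVector (ψ : EuclideanSpace ℝ (Fin m) → E) (x : EuclideanSpace ℝ (Fin m)) : E :=
  ∑ i, ∑ j, invMetric ψ x i j • partialDeriv i (partialDeriv j ψ) x +
    ∑ i, laplaceCoeff ψ x i • partialDeriv i ψ x

theorem differentiableAt_metricMatrix (hψ : ContDiffAt ℝ ∞ ψ x) (i j : Fin m) :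
    DifferentiableAt ℝ (fun y => metricMatrix ψ y i j) x :=
  (differentiableAt_partialDeriv hψ i).inner ℝ (differentiableAt_partialDeriv hψ j)

theorem partialDeriv_metricMatrix (hψ : ContDiffAt ℝ ∞ ψ x) (i j k : Fin m) :
    partialDeriv k (fun y => metricMatrix ψ y i j) x =
      inner ℝ (partialDeriv k (partialDeriv i ψ) x) (partialDeriv j ψ x) +
        inner ℝ (partialDeriv i ψ x) (partialDeriv k (partialDeriv j ψ) x) := by
  have h1 : (fun y => metricMatrix ψ y i j) =
    fun y => inner ℝ (partialDeriv i ψ y) (partialDeriv j ψ y) := rfl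
  rw [partialDeriv, h1, fderiv_inner_apply ℝ (differentiableAt_partialDeriv hψ i)
    (differentiableAt_partialDeriv hψ j), add_comm]
  rfl

theorem IsLocalParam.differentiableAt_sqrt_det (h : IsLocalParam M m U ψ) (hx : x ∈ U) :
    DifferentiableAt ℝ (fun y => √(metricMatrix ψ y).det) x :=
  (differentiableAt_det fun i j => differentiableAt_metricMatrix (h.contDiffAt hx) i j).sqrt
    (h.det_pos hx).ne'

theorem IsLocalParam.differentiableAt_invMetric (h : IsLocalParam M m U ψ) (hx : x ∈ U)
    (i j : Fin m) : DifferentiableAt ℝ (fun y => invMetric ψ y i j) x :=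
  differentiableAt_inv_apply (fun i j => differentiableAt_metricMatrix (h.contDiffAt hx) i j)
    (h.det_pos hx).ne' i j

/-- The derivative of the volume density. -/
theorem IsLocalParam.partialDeriv_sqrt_det (h : IsLocalParam M m U ψ) (hx : x ∈ U) (k : Fin m) :
    partialDeriv k (fun y => √(metricMatrix ψ y).det) x = √(metricMatrix ψ x).det *
      ∑ i, ∑ j, invMetric ψ x i j *
        inner ℝ (partialDeriv i ψ x) (partialDeriv k (partialDeriv j ψ) x) := by
  have hψ := h.contDiffAt hx
  have hdet := h.det_pos hx
  have h1 := hasFDerivAt_det fun i j => (differentiableAt_metricMatrix hψ i j).hasFDerivAt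
  have h2 := (h1.sqrt hdet.ne').fderiv
  have h3 : ∀ i j, (metricMatrix ψ x).adjugate i j =
      (metricMatrix ψ x).det * invMetric ψ x i j := by
    intro i j
    rw [invMetric, Matrix.inv_def, Matrix.smul_apply, Ring.inverse_eq_inv', smul_eq_mul,
      mul_inv_cancel_left₀ hdet.ne']
  have h4 : ∑ i, ∑ j, (metricMatrix ψ x).adjugate i j *
      partialDeriv k (fun y => metricMatrix ψ y j i) x = 2 * (metricMatrix ψ x).det *
      ∑ i, ∑ j, invMetric ψ x i j *
        inner ℝ (partialDeriv i ψ x) (partialDeriv k (partialDeriv j ψ) x) := by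
    simp only [h3, partialDeriv_metricMatrix hψ, mul_add, Finset.sum_add_distrib]
    rw [two_mul, add_mul]
    simp only [Finset.mul_sum]
    congr 1
    · refine Finset.sum_congr rfl fun i _ => Finset.sum_congr rfl fun j _ => ?_
      rw [real_inner_comm, mul_assoc]
    · rw [Finset.sum_comm]
      refine Finset.sum_congr rfl fun i _ => Finset.sum_congr rfl fun j _ => ?_
      rw [invMetric_symm, mul_assoc]
  rw [partialDeriv, h2]
  simp only [sum_apply, smul_apply, smul_eq_mul]
  rw [show (∑ i, ∑ j, (metricMatrix ψ x).adjugate i j *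
      fderiv ℝ (fun y => metricMatrix ψ y j i) x (EuclideanSpace.single k 1)) = _ from h4]
  have h5 : (metricMatrix ψ x).det = √(metricMatrix ψ x).det * √(metricMatrix ψ x).det :=
    (Real.mul_self_sqrt hdet.le).symm
  have h6 : √(metricMatrix ψ x).det ≠ 0 := (Real.sqrt_pos.2 hdet).ne'
  field_simp
  rw [Real.sq_sqrt hdet.le]

/-- Differentiating `∑_i g^ij √|g| g_ik = δ_jk √|g|` expresses the first-order coefficients through
derivatives of the metric and of the volume density. The right-hand side is minus the tangential
pairing of the traced second derivatives, which is why the tension vector is normal. -/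
theorem IsLocalParam.sum_laplaceCoeff_mul (h : IsLocalParam M m U ψ) (hx : x ∈ U) (k : Fin m) :
    ∑ i, laplaceCoeff ψ x i * metricMatrix ψ x i k =
      -∑ i, ∑ j, invMetric ψ x i j *
        inner ℝ (partialDeriv i (partialDeriv j ψ) x) (partialDeriv k ψ x) := by
  have hψ := h.contDiffAt hx
  have hdet := h.det_pos hx
  set s := fun y => √(metricMatrix ψ y).det with hs
  have hs0 : s x ≠ 0 := (Real.sqrt_pos.2 hdet).ne'
  have hsd : DifferentiableAt ℝ s x := h.differentiableAt_sqrt_det hx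
  have hid : ∀ i j, DifferentiableAt ℝ (fun y => invMetric ψ y i j * s y) x := fun i j =>
    (h.differentiableAt_invMetric hx i j).mul hsd
  -- the product rule for `∑ i, g^ij √|g| g_ik = δ_jk √|g|`
  have h1 : ∀ j, ∑ i, (partialDeriv j (fun y => invMetric ψ y i j * s y) x * metricMatrix ψ x i k +
      invMetric ψ x i j * s x * partialDeriv j (fun y => metricMatrix ψ y i k) x) =
      if j = k then partialDeriv k s x else 0 := by
    intro j
    have h2 : (fun y => ∑ i, invMetric ψ y i j * s y * metricMatrix ψ y i k) =ᶠ[𝓝 x]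
        fun y => if j = k then s y else 0 := by
      filter_upwards [h.isOpen_domain.eventually_mem hx] with y hy
      have h3 := h.sum_invMetric_mul hy j k
      calc _ = s y * ∑ i, invMetric ψ y i j * metricMatrix ψ y i k := by
            rw [Finset.mul_sum]
            exact Finset.sum_congr rfl fun i _ => by ring
        _ = _ := by rw [h3]; split_ifs <;> simp
    have h4 : HasFDerivAt (fun y => ∑ i, invMetric ψ y i j * s y * metricMatrix ψ y i k) _ x :=
      HasFDerivAt.fun_sum fun i _ =>
        (hid i j).hasFDerivAt.mul (differentiableAt_metricMatrix hψ i k).hasFDerivAt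
    have h5 := DFunLike.congr_fun h4.fderiv (EuclideanSpace.single j (1 : ℝ))
    rw [h2.fderiv_eq] at h5
    simp only [sum_apply, add_apply, smul_apply, smul_eq_mul] at h5
    calc _ = _ := Finset.sum_congr rfl fun i _ => by
          rw [add_comm, mul_comm (partialDeriv _ _ _)]
          rfl
      _ = _ := h5.symm
      _ = _ := by
        split_ifs with hjk
        · rw [hjk]; rfl
        · simp
  have h2 : ∑ i, laplaceCoeff ψ x i * metricMatrix ψ x i k = (1 / s x) *
      ∑ j, ∑ i, partialDeriv j (fun y => invMetric ψ y i j * s y) x * metricMatrix ψ x i k := by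
    rw [Finset.sum_comm, Finset.mul_sum]
    refine Finset.sum_congr rfl fun i _ => ?_
    rw [laplaceCoeff, Finset.sum_mul, Finset.mul_sum]
    exact Finset.sum_congr rfl fun j _ => mul_assoc _ _ _
  have h3 : ∑ j, ∑ i, partialDeriv j (fun y => invMetric ψ y i j * s y) x *
      metricMatrix ψ x i k = partialDeriv k s x - s x * ∑ j, ∑ i, invMetric ψ x i j *
        partialDeriv j (fun y => metricMatrix ψ y i k) x := by
    have h4 := Finset.sum_congr rfl fun j (_ : j ∈ Finset.univ) => h1 j
    rw [Finset.sum_ite_eq' Finset.univ k, if_pos (Finset.mem_univ k)] at h4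
    rw [← h4]
    simp only [Finset.sum_add_distrib, Finset.mul_sum]
    rw [eq_sub_iff_add_eq]
    congr 1
    exact Finset.sum_congr rfl fun j _ => Finset.sum_congr rfl fun i _ => by ring
  have h4 : partialDeriv k s x = s x * ∑ i, ∑ j, invMetric ψ x i j *
      inner ℝ (partialDeriv i ψ x) (partialDeriv k (partialDeriv j ψ) x) :=
    h.partialDeriv_sqrt_det hx k
  rw [h2, h3, h4, ← mul_sub, one_div, inv_mul_cancel_left₀ hs0]
  simp only [partialDeriv_metricMatrix hψ, mul_add, Finset.sum_add_distrib]
  -- By symmetry of second partials, one half of the derivative of `g_ik` is exactly the derivative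
  -- of the volume density, and the two cancel.
  have h5 : ∑ j, ∑ i, invMetric ψ x i j *
      inner ℝ (partialDeriv i ψ x) (partialDeriv j (partialDeriv k ψ) x) =
      ∑ i, ∑ j, invMetric ψ x i j *
        inner ℝ (partialDeriv i ψ x) (partialDeriv k (partialDeriv j ψ) x) := by
    rw [Finset.sum_comm]
    exact Finset.sum_congr rfl fun i _ => Finset.sum_congr rfl fun j _ => by
      rw [partialDeriv_comm hψ]
  rw [h5, sub_add_cancel_right]
  congr 1
  exact Finset.sum_congr rfl fun i _ => Finset.sum_congr rfl fun j _ => by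
    rw [invMetric_symm]

/-- The tension field of the inclusion is normal to the submanifold. -/
theorem IsLocalParam.inner_tensionVector (h : IsLocalParam M m U ψ) (hx : x ∈ U)
    (u : EuclideanSpace ℝ (Fin m)) : inner ℝ (tensionVector ψ x) (fderiv ℝ ψ x u) = 0 := by
  rw [fderiv_apply_eq_sum, inner_sum]
  refine Finset.sum_eq_zero fun k _ => ?_
  rw [inner_smul_right, tensionVector, inner_add_left]
  simp only [sum_inner, real_inner_smul_left]
  have h1 := h.sum_laplaceCoeff_mul hx k
  simp only [metricMatrix, Matrix.of_apply] at h1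
  rw [h1, add_neg_cancel, mul_zero]

/-- The Laplace-Beltrami operator on the restriction of a function on the ambient space. -/
theorem IsLocalParam.laplaceBeltrami_comp (h : IsLocalParam M m U ψ) (hx : x ∈ U) {f : E → ℂ}
    (hf : ContDiff ℝ ∞ f) :
    laplaceBeltrami ψ (f ∘ ψ) x =
      ∑ i, ∑ j, invMetric ψ x i j •
        fderiv ℝ (fderiv ℝ f) (ψ x) (partialDeriv i ψ x) (partialDeriv j ψ x) +
      fderiv ℝ f (ψ x) (tensionVector ψ x) := by
  have hψ := h.contDiffAt hx
  have hdet := h.det_pos hx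
  have hs0 : √(metricMatrix ψ x).det ≠ 0 := (Real.sqrt_pos.2 hdet).ne'
  have hfψ : ContDiffAt ℝ ∞ (f ∘ ψ) x := hf.contDiffAt.comp x hψ
  have h1 : ∀ i j, partialDeriv j (fun y => (invMetric ψ y i j * √(metricMatrix ψ y).det) •
      partialDeriv i (f ∘ ψ) y) x =
      (invMetric ψ x i j * √(metricMatrix ψ x).det) • partialDeriv j (partialDeriv i (f ∘ ψ)) x +
      partialDeriv j (fun y => invMetric ψ y i j * √(metricMatrix ψ y).det) x •
        partialDeriv i (f ∘ ψ) x := by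
    intro i j
    have h2 := HasFDerivAt.fun_smul ((h.differentiableAt_invMetric hx i j).fun_mul
      (h.differentiableAt_sqrt_det hx)).hasFDerivAt
      (differentiableAt_partialDeriv hfψ i).hasFDerivAt
    rw [partialDeriv, h2.fderiv]
    rfl
  have h3 : ∀ i j, (1 / √(metricMatrix ψ x).det) • partialDeriv j (fun y =>
      (invMetric ψ y i j * √(metricMatrix ψ y).det) • partialDeriv i (f ∘ ψ) y) x =
      invMetric ψ x i j •
        fderiv ℝ (fderiv ℝ f) (ψ x) (partialDeriv j ψ x) (partialDeriv i ψ x) +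
      fderiv ℝ f (ψ x) (invMetric ψ x i j • partialDeriv j (partialDeriv i ψ) x) +
      fderiv ℝ f (ψ x) (((1 / √(metricMatrix ψ x).det) *
        partialDeriv j (fun y => invMetric ψ y i j * √(metricMatrix ψ y).det) x) •
          partialDeriv i ψ x) := by
    intro i j
    rw [h1, smul_add, smul_smul, smul_smul, partialDeriv_partialDeriv_comp hf hψ,
      partialDeriv_comp ((hf.differentiable (by simp)) _) (hψ.differentiableAt (by simp)),
      map_smul, map_smul, ← smul_add]
    congr 2
    field_simp
  rw [laplaceBeltrami]
  simp only [h3, Finset.sum_add_distrib]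
  rw [tensionVector, map_add, add_assoc]
  simp only [laplaceCoeff, Finset.sum_smul, map_sum]
  congr 1
  · rw [Finset.sum_comm]
    exact Finset.sum_congr rfl fun i _ => Finset.sum_congr rfl fun j _ => by rw [invMetric_symm]
  · congr 1
    rw [Finset.sum_comm]
    exact Finset.sum_congr rfl fun i _ => Finset.sum_congr rfl fun j _ => by rw [invMetric_symm]

end Laplacian

/-! ### Matrices as a real Euclidean space; Hermitian matrices -/

section MatrixSpace

variable {n : ℕ}

@[simp] theorem toMatrix_apply (z : MatrixSpace n) (i j : Fin n) : toMatrix z i j = z (i, j) := rfl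

@[simp] theorem ofMatrix_apply (A : Matrix (Fin n) (Fin n) ℂ) (p : Fin n × Fin n) :
    ofMatrix A p = A p.1 p.2 := rfl

@[simp] theorem toMatrix_ofMatrix (A : Matrix (Fin n) (Fin n) ℂ) : toMatrix (ofMatrix A) = A := rfl

@[simp] theorem ofMatrix_toMatrix (z : MatrixSpace n) : ofMatrix (toMatrix z) = z := rfl

theorem toMatrix_injective : Function.Injective (toMatrix (n := n)) :=
  Function.LeftInverse.injective ofMatrix_toMatrix

@[simp] theorem toMatrix_zero : toMatrix (0 : MatrixSpace n) = 0 := rfl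

@[simp] theorem toMatrix_add (z w : MatrixSpace n) : toMatrix (z + w) = toMatrix z + toMatrix w :=
  rfl

@[simp] theorem toMatrix_sub (z w : MatrixSpace n) : toMatrix (z - w) = toMatrix z - toMatrix w :=
  rfl

@[simp] theorem toMatrix_smul (c : ℂ) (z : MatrixSpace n) : toMatrix (c • z) = c • toMatrix z := rfl

@[simp] theorem toMatrix_real_smul (c : ℝ) (z : MatrixSpace n) :
    toMatrix (c • z) = c • toMatrix z := rfl

theorem inner_eq_trace (z w : MatrixSpace n) :
    inner ℝ z w = (Matrix.trace (toMatrix z * (toMatrix w)ᴴ)).re :=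
  inner_ofMatrix (toMatrix z) (toMatrix w)

theorem toMatrix_single (i j : Fin n) (c : ℂ) :
    toMatrix (EuclideanSpace.single (i, j) c) = Matrix.single i j c := by
  ext k l
  simp [Matrix.single_apply, Prod.ext_iff, eq_comm]

theorem inner_single_one (u : MatrixSpace n) (p : Fin n × Fin n) :
    inner ℝ u (EuclideanSpace.single p (1 : ℂ)) = (u p).re := by
  rw [PiLp.inner_apply, Finset.sum_eq_single p] <;> simp +contextual [Complex.inner]

theorem inner_single_I (u : MatrixSpace n) (p : Fin n × Fin n) :
    inner ℝ u (EuclideanSpace.single p Complex.I) = (u p).im := by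
  rw [PiLp.inner_apply, Finset.sum_eq_single p] <;> simp +contextual [Complex.inner]

theorem finrank_matrixSpace : Module.finrank ℝ (MatrixSpace n) = 2 * n ^ 2 := by
  rw [finrank_real_of_complex, finrank_euclideanSpace, Fintype.card_prod, Fintype.card_fin, sq]

/-- The real subspace of Hermitian matrices. -/
def hermitian (n : ℕ) : Submodule ℝ (MatrixSpace n) where
  carrier := {z | (toMatrix z)ᴴ = toMatrix z}
  add_mem' {z w} hz hw := by
    simp only [Set.mem_ofPred_eq] at *
    rw [toMatrix_add, Matrix.conjTranspose_add, hz, hw]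
  zero_mem' := by simp
  smul_mem' c z hz := by
    simp only [Set.mem_ofPred_eq] at *
    rw [toMatrix_real_smul, Matrix.conjTranspose_smul, hz, star_trivial]

theorem mem_hermitian {z : MatrixSpace n} : z ∈ hermitian n ↔ (toMatrix z)ᴴ = toMatrix z := Iff.rfl

theorem hermitian_ext {a b : hermitian n}
    (h : toMatrix (a : MatrixSpace n) = toMatrix (b : MatrixSpace n)) : a = b :=
  Subtype.ext (toMatrix_injective h)

/-- Every complex matrix is uniquely of the form `A + iB` with Hermitian `A`, `B`. -/
def hermitianProdEquiv (n : ℕ) : (hermitian n × hermitian n) ≃ₗ[ℝ] MatrixSpace n where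
  toFun p := p.1 + Complex.I • (p.2 : MatrixSpace n)
  map_add' p q := by simp [add_add_add_comm]
  map_smul' c p := by
    change c • (p.1 : MatrixSpace n) + Complex.I • (c • (p.2 : MatrixSpace n)) = c • _
    rw [smul_add, smul_comm c]
  invFun z :=
    (⟨ofMatrix ((1 / 2 : ℂ) • (toMatrix z + (toMatrix z)ᴴ)), by
      rw [mem_hermitian, toMatrix_ofMatrix, Matrix.conjTranspose_smul, Matrix.conjTranspose_add,
        Matrix.conjTranspose_conjTranspose, add_comm]
      simp⟩,
     ⟨ofMatrix ((-Complex.I / 2 : ℂ) • (toMatrix z - (toMatrix z)ᴴ)), by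
      rw [mem_hermitian, toMatrix_ofMatrix, Matrix.conjTranspose_smul, Matrix.conjTranspose_sub,
        Matrix.conjTranspose_conjTranspose, ← neg_sub (toMatrix z), smul_neg, ← neg_smul]
      congr 1
      simp [neg_div]⟩)
  left_inv p := by
    obtain ⟨⟨a, ha⟩, ⟨b, hb⟩⟩ := p
    rw [mem_hermitian] at ha hb
    refine Prod.ext (hermitian_ext ?_) (hermitian_ext ?_)
    · simp only [toMatrix_ofMatrix, toMatrix_add, toMatrix_smul, Matrix.conjTranspose_add,
        Matrix.conjTranspose_smul, ha, hb]
      ext i j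
      simp
      ring
    · simp only [toMatrix_ofMatrix, toMatrix_add, toMatrix_smul, Matrix.conjTranspose_add,
        Matrix.conjTranspose_smul, ha, hb]
      ext i j
      simp
      linear_combination (-b (i, j)) * Complex.I_sq
  right_inv z := by
    apply toMatrix_injective
    ext i j
    simp
    linear_combination (-(z (i, j) - (starRingEnd ℂ) (z (j, i))) / 2) * Complex.I_sq

theorem finrank_hermitian : Module.finrank ℝ (hermitian n) = n ^ 2 := by
  have h1 := (hermitianProdEquiv n).finrank_eq
  rw [Module.finrank_prod, finrank_matrixSpace] at h1
  omega

/-- The Hermitian-valued symmetric bilinear map `Z W* + W Z*`. -/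
def hermForm (n : ℕ) : MatrixSpace n →L[ℝ] MatrixSpace n →L[ℝ] hermitian n :=
  LinearMap.toContinuousBilinearMap <| LinearMap.mk₂ ℝ
    (fun z w => (⟨ofMatrix (toMatrix z * (toMatrix w)ᴴ + toMatrix w * (toMatrix z)ᴴ), by
      simp [mem_hermitian, Matrix.conjTranspose_mul, add_comm]⟩ : hermitian n))
    (fun z z' w => hermitian_ext (by
      simp [Matrix.conjTranspose_add, add_mul, mul_add]; abel))
    (fun c z w => hermitian_ext (by
      simp [Matrix.conjTranspose_smul, smul_add]))
    (fun z w w' => hermitian_ext (by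
      simp [Matrix.conjTranspose_add, add_mul, mul_add]; abel))
    (fun c z w => hermitian_ext (by
      simp [Matrix.conjTranspose_smul, smul_add]))

theorem toMatrix_hermForm (z w : MatrixSpace n) :
    toMatrix (hermForm n z w : MatrixSpace n) =
      toMatrix z * (toMatrix w)ᴴ + toMatrix w * (toMatrix z)ᴴ := rfl

theorem hermForm_comm (z w : MatrixSpace n) : hermForm n z w = hermForm n w z :=
  hermitian_ext (by rw [toMatrix_hermForm, toMatrix_hermForm, add_comm])

end MatrixSpace

/-! ### Derivatives of quadratic maps -/

section Quadratic

variable {V F : Type*} [NormedAddCommGroup V] [NormedSpace ℝ V] [NormedAddCommGroup F]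
  [NormedSpace ℝ F] {B : V →L[ℝ] V →L[ℝ] F}

theorem contDiff_quadratic (B : V →L[ℝ] V →L[ℝ] F) : ContDiff ℝ ∞ fun z => B z z :=
  B.contDiff.clm_apply contDiff_id

theorem fderiv_quadratic (hB : ∀ u v, B u v = B v u) :
    fderiv ℝ (fun z => B z z) = (2 : ℝ) • B := by
  ext z u
  have h1 : HasFDerivAt (fun z => B z z) _ z := B.hasFDerivAt.clm_apply (hasFDerivAt_id z)
  rw [h1.fderiv]
  simp [two_smul, hB u z]

theorem fderiv_fderiv_quadratic (hB : ∀ u v, B u v = B v u) (z : V) :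
    fderiv ℝ (fderiv ℝ fun z => B z z) z = (2 : ℝ) • B := by
  rw [fderiv_quadratic hB]
  exact ((2 : ℝ) • B).fderiv

end Quadratic

/-! ### The unitary group as a level set and its tangential projection -/

section UnitaryGroup

variable {n : ℕ}

theorem mul_conjTranspose_of_mem {z : MatrixSpace n} (hz : z ∈ unitary n) :
    toMatrix z * (toMatrix z)ᴴ = 1 := Matrix.mem_unitaryGroup_iff.1 hz

theorem conjTranspose_mul_of_mem {z : MatrixSpace n} (hz : z ∈ unitary n) :
    (toMatrix z)ᴴ * toMatrix z = 1 := Matrix.mem_unitaryGroup_iff'.1 hz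

/-- Twice the identity matrix. -/
def hermTwo (n : ℕ) : hermitian n := ⟨ofMatrix 2, by
  rw [mem_hermitian, toMatrix_ofMatrix, ← one_add_one_eq_two]; simp⟩

theorem mem_unitary_iff {z : MatrixSpace n} : z ∈ unitary n ↔ hermForm n z z = hermTwo n := by
  constructor
  · intro h
    apply hermitian_ext
    rw [toMatrix_hermForm, mul_conjTranspose_of_mem h, one_add_one_eq_two]
    rfl
  · intro h
    have h1 := congrArg (fun a : hermitian n => toMatrix (a : MatrixSpace n)) h
    simp only [toMatrix_hermForm, hermTwo, toMatrix_ofMatrix, ← two_mul] at h1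
    refine Matrix.mem_unitaryGroup_iff.2 ?_
    ext i j
    have h2 := congrFun (congrFun h1 i) j
    rw [two_mul, ← one_add_one_eq_two, Matrix.add_apply, Matrix.add_apply, ← two_mul,
      ← two_mul] at h2
    exact mul_left_cancel₀ two_ne_zero h2

theorem fderiv_hermForm_apply (z u : MatrixSpace n) :
    fderiv ℝ (fun z => hermForm n z z) z u = (2 : ℝ) • hermForm n z u := by
  rw [fderiv_quadratic hermForm_comm]
  rfl

/-- Since `zz* = 1`, pairing `z` with `Hz` gives `2H`. The factor `1/4` is chosen because the
derivative of the quadratic map is twice the form. -/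
theorem hermForm_smul_mul (h : hermitian n) {z : MatrixSpace n} (hz : z ∈ unitary n) :
    hermForm n z ((1 / 4 : ℝ) • ofMatrix (toMatrix (h : MatrixSpace n) * toMatrix z)) =
      (1 / 2 : ℝ) • h := by
  apply hermitian_ext
  have h1 := mem_hermitian.1 h.2
  rw [map_smul]
  change (1 / 4 : ℝ) • toMatrix (hermForm n z _ : MatrixSpace n) = (1 / 2 : ℝ) • toMatrix _
  rw [toMatrix_hermForm, toMatrix_ofMatrix, Matrix.conjTranspose_mul, h1, ← Matrix.mul_assoc,
    Matrix.mul_assoc _ (toMatrix z) _, mul_conjTranspose_of_mem hz, Matrix.mul_one, Matrix.one_mul,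
    ← two_smul ℝ, smul_smul]
  norm_num

theorem surjective_fderiv_hermForm {z : MatrixSpace n} (hz : z ∈ unitary n) :
    Function.Surjective (fderiv ℝ (fun z => hermForm n z z) z) := by
  intro h
  refine ⟨(1 / 4 : ℝ) • ofMatrix (toMatrix (h : MatrixSpace n) * toMatrix z),
    (fderiv_hermForm_apply z _).trans ?_⟩
  rw [hermForm_smul_mul h hz, smul_smul]
  norm_num

theorem isSubmanifold_unitary (n : ℕ) : IsSubmanifold (unitary n) (n ^ 2) :=
  isSubmanifold_of_regular (contDiff_quadratic (hermForm n)) (fun _ => mem_unitary_iff)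
    (fun _ hp => surjective_fderiv_hermForm hp)
    (by rw [finrank_matrixSpace, finrank_hermitian]; ring)

theorem isCompact_unitary (n : ℕ) : IsCompact (unitary n) := by
  have h1 : IsClosed (unitary n) := by
    have : unitary n = (fun z => hermForm n z z) ⁻¹' {hermTwo n} := by
      ext z
      exact mem_unitary_iff
    rw [this]
    exact isClosed_singleton.preimage (contDiff_quadratic (hermForm n)).continuous
  refine Metric.isCompact_of_isClosed_isBounded h1
    ((Metric.isBounded_iff_subset_closedBall 0).2 ⟨√n, fun z hz => ?_⟩)
  rw [mem_closedBall_zero_iff]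
  refine Real.le_sqrt_of_sq_le ?_
  rw [← real_inner_self_eq_norm_sq, inner_eq_trace, mul_conjTranspose_of_mem hz]
  simp

/-- The tangential projection at a point of the unitary group. -/
def tangentProj (z w : MatrixSpace n) : MatrixSpace n :=
  (1 / 2 : ℝ) • ofMatrix (toMatrix w - toMatrix z * (toMatrix w)ᴴ * toMatrix z)

theorem toMatrix_tangentProj (z w : MatrixSpace n) : toMatrix (tangentProj z w) =
    (1 / 2 : ℝ) • (toMatrix w - toMatrix z * (toMatrix w)ᴴ * toMatrix z) := rfl

theorem hermForm_eq_zero_iff {z u : MatrixSpace n} : hermForm n z u = 0 ↔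
    toMatrix z * (toMatrix u)ᴴ + toMatrix u * (toMatrix z)ᴴ = 0 :=
  ⟨fun h => by rw [← toMatrix_hermForm, h]; rfl, fun h => hermitian_ext (by
    rw [toMatrix_hermForm, h]; rfl)⟩

/-- The projection times `z*` is `(w z* - z w*)/2`, which is skew-Hermitian. -/
theorem hermForm_tangentProj {z : MatrixSpace n} (hz : z ∈ unitary n) (w : MatrixSpace n) :
    hermForm n z (tangentProj z w) = 0 := by
  have h1 := mul_conjTranspose_of_mem hz
  rw [hermForm_eq_zero_iff, toMatrix_tangentProj, Matrix.conjTranspose_smul, star_trivial,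
    Matrix.mul_smul, Matrix.smul_mul, ← smul_add, Matrix.conjTranspose_sub, Matrix.sub_mul,
    Matrix.mul_sub, Matrix.mul_assoc _ _ (toMatrix z)ᴴ, h1, Matrix.conjTranspose_mul,
    Matrix.conjTranspose_mul, Matrix.conjTranspose_conjTranspose, ← Matrix.mul_assoc (toMatrix z),
    h1]
  simp

/-- The residual is `(w + z w* z)/2`, and because `u z*` is skew-Hermitian, `⟨u, z w* z⟩ = -⟨w, u⟩`.
-/
theorem inner_sub_tangentProj {z u : MatrixSpace n} (hz : z ∈ unitary n)
    (hu : hermForm n z u = 0) (w : MatrixSpace n) : inner ℝ u (w - tangentProj z w) = 0 := by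
  have h1 : w - tangentProj z w =
      (1 / 2 : ℝ) • (w + ofMatrix (toMatrix z * (toMatrix w)ᴴ * toMatrix z)) := by
    apply toMatrix_injective
    rw [toMatrix_sub, toMatrix_tangentProj, toMatrix_real_smul, toMatrix_add, toMatrix_ofMatrix]
    module
  have h2 : toMatrix u * (toMatrix z)ᴴ = -(toMatrix z * (toMatrix u)ᴴ) :=
    eq_neg_of_add_eq_zero_right (hermForm_eq_zero_iff.1 hu)
  have h3 : inner ℝ u (ofMatrix (toMatrix z * (toMatrix w)ᴴ * toMatrix z)) = -inner ℝ w u := by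
    rw [inner_eq_trace, toMatrix_ofMatrix, Matrix.conjTranspose_mul, Matrix.conjTranspose_mul,
      Matrix.conjTranspose_conjTranspose, ← Matrix.mul_assoc, h2, Matrix.trace_mul_comm,
      Matrix.mul_neg, Matrix.mul_assoc, ← Matrix.mul_assoc (toMatrix z)ᴴ,
      conjTranspose_mul_of_mem hz, Matrix.one_mul, Matrix.trace_neg, Complex.neg_re,
      inner_eq_trace]
  rw [h1, inner_smul_right, inner_add_right, h3, real_inner_comm, add_neg_cancel, mul_zero]

/-- The real part of the trace of the form is `2⟨z, u⟩`. So the position vector is normal to the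
unitary group. -/
theorem inner_eq_zero_of_hermForm_eq_zero {z u : MatrixSpace n} (hu : hermForm n z u = 0) :
    inner ℝ z u = 0 := by
  have h1 := congrArg (fun A => (Matrix.trace A).re) (hermForm_eq_zero_iff.1 hu)
  simp only [Matrix.trace_add, Complex.add_re, ← inner_eq_trace, Matrix.trace_zero,
    Complex.zero_re] at h1
  rw [real_inner_comm z u] at h1
  linarith

variable {m : ℕ} {U : Set (EuclideanSpace ℝ (Fin m))} {ψ : EuclideanSpace ℝ (Fin m) → MatrixSpace n}
  {x : EuclideanSpace ℝ (Fin m)}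

theorem IsLocalParam.hermForm_fderiv {K : Set (MatrixSpace n)} (h : IsLocalParam K m U ψ)
    (hK : K ⊆ unitary n) (hx : x ∈ U) (u : EuclideanSpace ℝ (Fin m)) :
    hermForm n (ψ x) (fderiv ℝ ψ x u) = 0 := by
  have h1 := h.range_fderiv_le_ker hx (contDiff_quadratic (hermForm n))
    (fun p hp => mem_unitary_iff.1 (hK hp)) ⟨u, rfl⟩
  have h2 : fderiv ℝ (fun z => hermForm n z z) (ψ x) (fderiv ℝ ψ x u) = 0 := h1
  rw [fderiv_hermForm_apply] at h2
  exact (smul_eq_zero.1 h2).resolve_left two_ne_zero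

section Trace

variable {P : MatrixSpace n → MatrixSpace n}
  (hP : ∀ w, ∑ i, ∑ j, (invMetric ψ x i j * inner ℝ (partialDeriv j ψ x) w) • partialDeriv i ψ x =
    P w)

include hP

/-- Metric traces of complex bilinear expressions from the tangential projection. -/
theorem sum_invMetric_mul_coord (l : MatrixSpace n →L[ℝ] ℂ) (p : Fin n × Fin n) :
    ∑ i, ∑ j, invMetric ψ x i j • (l (partialDeriv i ψ x) * partialDeriv j ψ x p) =
      l (P (EuclideanSpace.single p 1)) +
        l (P (EuclideanSpace.single p Complex.I)) * Complex.I := by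
  rw [← hP, ← hP]
  simp only [map_sum, map_smul, Finset.sum_mul, ← Finset.sum_add_distrib, inner_single_one,
    inner_single_I, Complex.real_smul]
  refine Finset.sum_congr rfl fun i _ => Finset.sum_congr rfl fun j _ => ?_
  conv_lhs => rw [← Complex.re_add_im (partialDeriv j ψ x p)]
  push_cast
  ring

/-- Metric traces of sesquilinear expressions from the tangential projection. -/
theorem sum_invMetric_mul_star_coord (l : MatrixSpace n →L[ℝ] ℂ) (p : Fin n × Fin n) :
    ∑ i, ∑ j, invMetric ψ x i j • (l (partialDeriv i ψ x) * star (partialDeriv j ψ x p)) =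
      l (P (EuclideanSpace.single p 1)) -
        l (P (EuclideanSpace.single p Complex.I)) * Complex.I := by
  rw [← hP, ← hP]
  simp only [map_sum, map_smul, Finset.sum_mul, ← Finset.sum_sub_distrib, inner_single_one,
    inner_single_I, Complex.real_smul]
  refine Finset.sum_congr rfl fun i _ => Finset.sum_congr rfl fun j _ => ?_
  have h1 : star (partialDeriv j ψ x p) =
      (partialDeriv j ψ x p).re - (partialDeriv j ψ x p).im * Complex.I := by
    apply Complex.ext <;> simp
  rw [h1]
  push_cast
  ring

end Trace

/-- A matrix entry as a real-linear functional. -/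
def entry (p : Fin n × Fin n) : MatrixSpace n →L[ℝ] ℂ :=
  (EuclideanSpace.proj p : MatrixSpace n →L[ℂ] ℂ).restrictScalars ℝ

@[simp] theorem entry_apply (p : Fin n × Fin n) (z : MatrixSpace n) : entry p z = z p := rfl

theorem tangentProj_single_apply (z : MatrixSpace n) (c : ℂ) (i j k l : Fin n) :
    tangentProj z (EuclideanSpace.single (k, l) c) (i, j) =
      (1 / 2) * ((if i = k ∧ j = l then c else 0) - star c * z (i, l) * z (k, j)) := by
  rw [← toMatrix_apply, toMatrix_tangentProj, toMatrix_single, Matrix.conjTranspose_single,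
    Matrix.smul_apply, Matrix.sub_apply, Matrix.mul_assoc, Matrix.mul_apply,
    Finset.sum_eq_single l]
  · simp [Matrix.single_apply, eq_comm]
    ring
  · intro b _ hb
    simp [Matrix.single_mul_apply_of_ne _ _ _ _ _ hb]
  · simp

end UnitaryGroup

/-! ### Metric traces of the coordinate functions on the unitary group -/

section UnitaryCoordinates

variable {n : ℕ} {U : Set (EuclideanSpace ℝ (Fin (n ^ 2)))}
  {ψ : EuclideanSpace ℝ (Fin (n ^ 2)) → MatrixSpace n} {x : EuclideanSpace ℝ (Fin (n ^ 2))}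

theorem IsLocalParam.mem_range_of_hermForm (h : IsLocalParam (unitary n) (n ^ 2) U ψ) (hx : x ∈ U)
    {u : MatrixSpace n} (hu : hermForm n (ψ x) u = 0) :
    u ∈ LinearMap.range (fderiv ℝ ψ x).toLinearMap := by
  rw [h.range_fderiv_eq_ker hx (contDiff_quadratic (hermForm n)) (fun p => mem_unitary_iff.1)
    (surjective_fderiv_hermForm (h.mem hx))
    (by rw [finrank_matrixSpace, finrank_hermitian]; ring)]
  change fderiv ℝ (fun z => hermForm n z z) (ψ x) u = 0
  rw [fderiv_hermForm_apply, hu, smul_zero]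

theorem IsLocalParam.sum_invMetric_smul_unitary (h : IsLocalParam (unitary n) (n ^ 2) U ψ)
    (hx : x ∈ U) (w : MatrixSpace n) :
    ∑ i, ∑ j, (invMetric ψ x i j * inner ℝ (partialDeriv j ψ x) w) • partialDeriv i ψ x =
      tangentProj (ψ x) w :=
  h.sum_invMetric_smul hx
    (h.mem_range_of_hermForm hx (hermForm_tangentProj (h.mem hx) w))
    fun u => inner_sub_tangentProj (h.mem hx) (h.hermForm_fderiv subset_rfl hx u) w

/-- For a real-linear `f`, the combination `f(1) + i f(i)` kills the complex-linear part and doubles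
the antilinear one, here `-c̄ z_il z_kj / 2`. The companion difference keeps the linear part
instead. -/
theorem tangentProj_single_add (z : MatrixSpace n) (i j k l : Fin n) :
    tangentProj z (EuclideanSpace.single (k, l) 1) (i, j) +
      tangentProj z (EuclideanSpace.single (k, l) Complex.I) (i, j) * Complex.I =
      -(z (i, l) * z (k, j)) := by
  simp only [tangentProj_single_apply]
  split_ifs
  · simp
    linear_combination (1 / 2) * (z (i, l) * z (k, j) + 1) * Complex.I_sq
  · simp
    linear_combination (1 / 2) * (z (i, l) * z (k, j)) * Complex.I_sq

theorem tangentProj_single_sub (z : MatrixSpace n) (i j k l : Fin n) :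
    tangentProj z (EuclideanSpace.single (k, l) 1) (i, j) -
      tangentProj z (EuclideanSpace.single (k, l) Complex.I) (i, j) * Complex.I =
      if i = k ∧ j = l then 1 else 0 := by
  simp only [tangentProj_single_apply]
  split_ifs
  · simp
    linear_combination (-1 / 2) * (z (i, l) * z (k, j) + 1) * Complex.I_sq
  · simp
    linear_combination (-1 / 2) * (z (i, l) * z (k, j)) * Complex.I_sq

theorem IsLocalParam.sum_entry_mul_entry (h : IsLocalParam (unitary n) (n ^ 2) U ψ) (hx : x ∈ U)
    (i j k l : Fin n) :
    ∑ s, ∑ t, invMetric ψ x s t • (partialDeriv s ψ x (i, j) * partialDeriv t ψ x (k, l)) =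
      -(ψ x (i, l) * ψ x (k, j)) :=
  (sum_invMetric_mul_coord (h.sum_invMetric_smul_unitary hx) (entry (i, j)) (k, l)).trans
    (tangentProj_single_add _ _ _ _ _)

theorem IsLocalParam.sum_entry_mul_star_entry (h : IsLocalParam (unitary n) (n ^ 2) U ψ)
    (hx : x ∈ U) (i j k l : Fin n) :
    ∑ s, ∑ t, invMetric ψ x s t • (partialDeriv s ψ x (i, j) * star (partialDeriv t ψ x (k, l))) =
      if i = k ∧ j = l then 1 else 0 :=
  (sum_invMetric_mul_star_coord (h.sum_invMetric_smul_unitary hx) (entry (i, j)) (k, l)).trans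
    (tangentProj_single_sub _ _ _ _ _)

end UnitaryCoordinates

/-! ### Derivatives of `Φ_a` and Euler's identities -/

section PhiDerivatives

variable {n : ℕ} [NeZero n]

theorem contDiff_Phi (d : ℕ) (a : Fin n → ℂ) : ContDiff ℝ ∞ (Phi d a) := by
  refine ContDiff.sum fun k _ => contDiff_const.mul (ContDiff.pow ?_ d)
  exact (entry (0, k)).contDiff

/-- The partial derivatives of `Φ_a` with respect to the first row. -/
def phiCoeff (d : ℕ) (a : Fin n → ℂ) (z : MatrixSpace n) (k : Fin n) : ℂ :=
  a k * (d * z (0, k) ^ (d - 1))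

theorem fderiv_Phi (d : ℕ) (a : Fin n → ℂ) :
    fderiv ℝ (Phi d a) = fun z => ∑ k, phiCoeff d a z k • entry (0, k) := by
  ext1 z
  have h1 : HasFDerivAt (fun z : MatrixSpace n => ∑ k, a k * entry (0, k) z ^ d) _ z :=
    HasFDerivAt.fun_sum fun k _ => (((entry (0, k)).hasFDerivAt.pow d).const_mul (a k))
  refine h1.fderiv.trans (Finset.sum_congr rfl fun k _ => ?_)
  ext u
  simp [phiCoeff, mul_assoc]

theorem fderiv_Phi_apply (d : ℕ) (a : Fin n → ℂ) (z u : MatrixSpace n) :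
    fderiv ℝ (Phi d a) z u = ∑ k, phiCoeff d a z k * u (0, k) := by
  rw [fderiv_Phi]
  simp

theorem fderiv_fderiv_Phi_apply (d : ℕ) (a : Fin n → ℂ) (z u v : MatrixSpace n) :
    fderiv ℝ (fderiv ℝ (Phi d a)) z u v =
      ∑ k, a k * (d * ((d - 1 : ℕ) * z (0, k) ^ (d - 1 - 1))) * (u (0, k) * v (0, k)) := by
  rw [fderiv_Phi]
  have h0 : ∀ k, HasFDerivAt (fun z : MatrixSpace n => a k * (d * entry (0, k) z ^ (d - 1))) _ z :=
    fun k => (((entry (0, k)).hasFDerivAt.pow (d - 1)).const_mul (d : ℂ)).const_mul (a k)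
  have h1 : HasFDerivAt
      (fun z : MatrixSpace n => ∑ k, phiCoeff d a z k • entry (n := n) (0, k)) _ z :=
    HasFDerivAt.fun_sum fun k _ => (h0 k).smul_const (entry (0, k))
  rw [h1.fderiv]
  simp [mul_assoc]

theorem sum_phiCoeff_mul (d : ℕ) (hd : 0 < d) (a : Fin n → ℂ) (z : MatrixSpace n) :
    ∑ k, phiCoeff d a z k * z (0, k) = d * Phi d a z := by
  rw [Phi, Finset.mul_sum]
  refine Finset.sum_congr rfl fun k _ => ?_
  obtain ⟨e, rfl⟩ := Nat.exists_eq_succ_of_ne_zero hd.ne'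
  simp only [phiCoeff, Nat.succ_sub_one, toMatrix_apply, Nat.succ_eq_add_one, pow_succ]
  ring

theorem sum_phiCoeff_deriv_mul (d : ℕ) (a : Fin n → ℂ) (z : MatrixSpace n) :
    ∑ k, a k * (d * ((d - 1 : ℕ) * z (0, k) ^ (d - 1 - 1))) * (z (0, k) * z (0, k)) =
      d * (d - 1 : ℕ) * Phi d a z := by
  rw [Phi, Finset.mul_sum]
  refine Finset.sum_congr rfl fun k _ => ?_
  -- For `d = 1` the exponent `d - 1 - 1` truncates to zero, but the factor `d - 1` vanishes; for `d
  -- = 0` the factor `d` does.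
  rcases d with _ | _ | e
  · simp
  · simp
  · simp only [toMatrix_apply, Nat.add_sub_cancel]
    ring

end PhiDerivatives

/-! ### Tension of the inclusion and the eigenfunction property -/

section Eigenfunction

variable {n : ℕ} {U : Set (EuclideanSpace ℝ (Fin (n ^ 2)))}
  {ψ : EuclideanSpace ℝ (Fin (n ^ 2)) → MatrixSpace n} {x : EuclideanSpace ℝ (Fin (n ^ 2))}

/-- The factor 2 arises because the two summands of the form are exchanged by swapping `s` and `t`,
under which the inverse metric is symmetric. -/
theorem toMatrix_sum_hermForm {m : ℕ} (ψ : EuclideanSpace ℝ (Fin m) → MatrixSpace n)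
    (x : EuclideanSpace ℝ (Fin m)) (i k : Fin n) :
    toMatrix ((∑ s, ∑ t, invMetric ψ x s t • hermForm n (partialDeriv s ψ x)
      (partialDeriv t ψ x) : hermitian n) : MatrixSpace n) i k =
      2 * ∑ l, ∑ s, ∑ t, invMetric ψ x s t •
        (partialDeriv s ψ x (i, l) * star (partialDeriv t ψ x (k, l))) := by
  have key : ∑ s, ∑ t, invMetric ψ x s t • (toMatrix (partialDeriv s ψ x) *
      (toMatrix (partialDeriv t ψ x))ᴴ) i k = ∑ l, ∑ s, ∑ t, invMetric ψ x s t •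
        (partialDeriv s ψ x (i, l) * star (partialDeriv t ψ x (k, l))) := by
    simp only [Matrix.mul_apply, Matrix.conjTranspose_apply, toMatrix_apply, Finset.smul_sum]
    rw [Finset.sum_congr rfl fun s _ => Finset.sum_comm, Finset.sum_comm]
  let ev : hermitian n →ₗ[ℝ] ℂ := (entry (i, k)).toLinearMap.comp (hermitian n).subtype
  have h4 : ∀ u v, ev (hermForm n u v) = (toMatrix u * (toMatrix v)ᴴ) i k +
    (toMatrix v * (toMatrix u)ᴴ) i k := fun u v => rfl
  change ev (∑ s, ∑ t, invMetric ψ x s t •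
    hermForm n (partialDeriv s ψ x) (partialDeriv t ψ x)) = _
  simp only [map_sum, map_smul, h4, smul_add, Finset.sum_add_distrib]
  rw [two_mul, key]
  congr 1
  rw [Finset.sum_comm, Finset.sum_congr rfl fun s _ => Finset.sum_congr rfl fun t _ => by
    rw [invMetric_symm], key]

/-- The normal part, with respect to the unitary group, of the contracted second derivatives. -/
theorem IsLocalParam.hermForm_sum_partialDeriv {m : ℕ} {K : Set (MatrixSpace n)}
    {U : Set (EuclideanSpace ℝ (Fin m))} {ψ : EuclideanSpace ℝ (Fin m) → MatrixSpace n}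
    {x : EuclideanSpace ℝ (Fin m)} (h : IsLocalParam K m U ψ) (hK : K ⊆ unitary n) (hx : x ∈ U) :
    hermForm n (ψ x) (∑ i, ∑ j, invMetric ψ x i j • partialDeriv i (partialDeriv j ψ) x) =
      -∑ i, ∑ j, invMetric ψ x i j • hermForm n (partialDeriv i ψ x) (partialDeriv j ψ x) := by
  have h1 := h.sum_fderiv_fderiv_add hx (contDiff_quadratic (hermForm n))
    (fun p hp => mem_unitary_iff.1 (hK hp)) (invMetric ψ x)
  rw [fderiv_fderiv_quadratic hermForm_comm, fderiv_hermForm_apply] at h1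
  have h4 : ∑ i, ∑ j, invMetric ψ x i j •
      ((2 : ℝ) • hermForm n) (partialDeriv i ψ x) (partialDeriv j ψ x) = (2 : ℝ) •
      ∑ i, ∑ j, invMetric ψ x i j • hermForm n (partialDeriv i ψ x) (partialDeriv j ψ x) := by
    simp only [smul_apply, Finset.smul_sum]
    exact Finset.sum_congr rfl fun i _ => Finset.sum_congr rfl fun j _ => smul_comm _ _ _
  rw [h4, ← smul_add] at h1
  exact eq_neg_of_add_eq_zero_right ((smul_eq_zero.1 h1).resolve_left two_ne_zero)

/-- The tension field of the inclusion of the unitary group. -/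
theorem IsLocalParam.tensionVector_unitary (h : IsLocalParam (unitary n) (n ^ 2) U ψ) (hx : x ∈ U) :
    tensionVector ψ x = (-n : ℝ) • ψ x := by
  have h2 : ∑ i, ∑ j, invMetric ψ x i j • hermForm n (partialDeriv i ψ x) (partialDeriv j ψ x) =
      (n : ℝ) • hermTwo n := by
    apply hermitian_ext
    ext i k
    rw [toMatrix_sum_hermForm,
      Finset.sum_congr rfl fun l _ => h.sum_entry_mul_star_entry hx i l k l]
    change _ = (n : ℝ) • (2 : Matrix (Fin n) (Fin n) ℂ) i k
    rw [← one_add_one_eq_two (R := Matrix (Fin n) (Fin n) ℂ), Matrix.add_apply, Matrix.one_apply]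
    split_ifs with hik <;> simp [hik]
    ring
  have h3 := h.hermForm_sum_partialDeriv subset_rfl hx
  rw [h2] at h3
  set z := ψ x with hz
  have hzU : z ∈ unitary n := h.mem hx
  set L := ∑ i, ∑ j, invMetric ψ x i j • partialDeriv i (partialDeriv j ψ) x with hL
  -- This makes `tensionVector + n z` tangent. Both summands are also normal, so it vanishes.
  have h4 : hermForm n z (tensionVector ψ x + (n : ℝ) • z) = 0 := by
    have h5 : hermForm n z (∑ i, laplaceCoeff ψ x i • partialDeriv i ψ x) = 0 := by
      rw [map_sum]
      refine Finset.sum_eq_zero fun i _ => ?_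
      rw [map_smul]
      exact smul_eq_zero_of_right _ (h.hermForm_fderiv subset_rfl hx _)
    have h6 : tensionVector ψ x = L + ∑ i, laplaceCoeff ψ x i • partialDeriv i ψ x := rfl
    rw [h6, map_add, map_add, h3, h5, map_smul, mem_unitary_iff.1 hzU, add_zero, neg_add_cancel]
  obtain ⟨u, hu⟩ := h.mem_range_of_hermForm hx h4
  have h5 : inner ℝ (tensionVector ψ x + (n : ℝ) • z) (fderiv ℝ ψ x u) = 0 := by
    rw [inner_add_left, h.inner_tensionVector hx, real_inner_smul_left,
      inner_eq_zero_of_hermForm_eq_zero (h.hermForm_fderiv subset_rfl hx u)]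
    simp
  have h6 : tensionVector ψ x + (n : ℝ) • z = 0 := by
    rw [ContinuousLinearMap.coe_coe] at hu
    rw [hu] at h5
    exact inner_self_eq_zero.1 h5
  rw [neg_smul]
  exact eq_neg_of_add_eq_zero_left h6

theorem sum_smul_sum_mul {ι κ : Type*} [Fintype ι] [Fintype κ] (g : Matrix ι ι ℝ) (c : κ → ℂ)
    (w : ι → ι → κ → ℂ) :
    ∑ i, ∑ j, g i j • ∑ k, c k * w i j k = ∑ k, c k * ∑ i, ∑ j, g i j • w i j k := by
  simp only [Finset.smul_sum, Finset.mul_sum, mul_smul_comm]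
  rw [Finset.sum_congr rfl fun i _ => Finset.sum_comm, Finset.sum_comm]

theorem sum_mul_sum_mul_sum {ι κ R : Type*} [Fintype ι] [Fintype κ] [CommSemiring R]
    (g : ι → ι → R) (c : κ → R) (u : ι → κ → R) :
    ∑ i, ∑ j, g i j * (∑ k, c k * u i k) * (∑ l, c l * u j l) =
      ∑ k, ∑ l, c k * c l * ∑ i, ∑ j, g i j * (u i k * u j l) := by
  have h1 : ∀ i j, g i j * (∑ k, c k * u i k) * (∑ l, c l * u j l) =
      ∑ k, ∑ l, c k * c l * (g i j * (u i k * u j l)) := fun i j => by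
    rw [mul_assoc, Finset.sum_mul_sum, Finset.mul_sum]
    refine Finset.sum_congr rfl fun k _ => ?_
    rw [Finset.mul_sum]
    exact Finset.sum_congr rfl fun l _ => by ring
  simp only [h1]
  simp only [Finset.mul_sum]
  rw [Finset.sum_congr rfl fun i _ => Finset.sum_comm, Finset.sum_comm]
  refine Finset.sum_congr rfl fun k _ => ?_
  rw [Finset.sum_congr rfl fun i _ => Finset.sum_comm, Finset.sum_comm]

variable [NeZero n]

/-- Within the first row the traces are `-z_1k z_1l`, so the Hessian term contributes `-d(d-1)Φ_a`,
the tension vector `-n z` contributes `-n d Φ_a`, and `κ` is minus the square of the Euler sum `d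
Φ_a`. -/
theorem isEigenfunction_Phi (d : ℕ) (hd : 0 < d) (a : Fin n → ℂ) :
    IsEigenfunction (unitary n) (n ^ 2) (Phi d a) := by
  refine ⟨fun U ψ h => (contDiff_Phi d a).comp_contDiffOn h.contDiffOn,
    -(d * (d - 1 : ℕ)) - n * d, -(d ^ 2 : ℂ), fun U ψ h x hx => ⟨?_, ?_⟩⟩
  · rw [h.laplaceBeltrami_comp hx (contDiff_Phi d a), h.tensionVector_unitary hx]
    simp only [fderiv_fderiv_Phi_apply]
    rw [sum_smul_sum_mul,
      Finset.sum_congr rfl fun k _ => congrArg _ (h.sum_entry_mul_entry hx 0 k 0 k)]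
    simp only [mul_neg, Finset.sum_neg_distrib, sum_phiCoeff_deriv_mul]
    rw [map_smul, fderiv_Phi_apply, sum_phiCoeff_mul d hd, Complex.real_smul]
    push_cast
    ring
  · have h1 : ∀ i, partialDeriv i (Phi d a ∘ ψ) x =
        ∑ k, phiCoeff d a (ψ x) k * partialDeriv i ψ x (0, k) := fun i => by
      rw [partialDeriv_comp ((contDiff_Phi d a).differentiable (by simp) _)
        ((h.contDiffAt hx).differentiableAt (by simp)), fderiv_Phi_apply]
    have h2 : conformality ψ (Phi d a ∘ ψ) (Phi d a ∘ ψ) x =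
        ∑ k, ∑ l, phiCoeff d a (ψ x) k * phiCoeff d a (ψ x) l * ∑ i, ∑ j,
          invMetric ψ x i j • (partialDeriv i ψ x (0, k) * partialDeriv j ψ x (0, l)) := by
      rw [conformality]
      simp only [h1, sum_mul_sum_mul_sum, Complex.real_smul]
    rw [h2]
    simp only [h.sum_entry_mul_entry hx]
    calc _ = -((∑ k, phiCoeff d a (ψ x) k * ψ x (0, k)) *
          ∑ l, phiCoeff d a (ψ x) l * ψ x (0, l)) := by
          rw [Finset.sum_mul_sum, ← Finset.sum_neg_distrib]
          simp only [← Finset.sum_neg_distrib]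
          exact Finset.sum_congr rfl fun k _ => Finset.sum_congr rfl fun l _ => by ring
      _ = _ := by
          rw [sum_phiCoeff_mul d hd]
          ring

end Eigenfunction

/-! ### Submersivity, and what the first row of a unitary matrix can be -/

section FirstRow

variable {n : ℕ}

theorem hermForm_I_smul {z : MatrixSpace n} (hz : z ∈ unitary n) :
    hermForm n z (Complex.I • z) = 0 := by
  rw [hermForm_eq_zero_iff, toMatrix_smul, Matrix.conjTranspose_smul, Matrix.mul_smul,
    Matrix.smul_mul, mul_conjTranspose_of_mem hz]
  simp

theorem isOpen_paramSet : IsOpen (paramSet n) := by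
  simp only [paramSet, Set.ofPred_forall]
  exact isOpen_iInter_of_finite fun k => isOpen_ne.preimage (continuous_apply k)

theorem paramSet_nonempty : (paramSet n).Nonempty := ⟨1, fun _ => one_ne_zero⟩

variable [NeZero n]

theorem sum_mul_star_row {z : MatrixSpace n} (hz : z ∈ unitary n) :
    ∑ k, z (0, k) * star (z (0, k)) = 1 := by
  have h1 := congrFun (congrFun (mul_conjTranspose_of_mem hz) 0) 0
  rwa [Matrix.mul_apply, Matrix.one_apply_eq] at h1

/-- The matrix with first row `r` and all other rows zero. -/
def rowMatrix (r : Fin n → ℂ) : MatrixSpace n := ofMatrix fun i k => if i = 0 then r k else 0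

theorem rowMatrix_apply (r : Fin n → ℂ) (i k : Fin n) :
    rowMatrix r (i, k) = if i = 0 then r k else 0 := rfl

theorem tangentProj_rowMatrix_apply (z : MatrixSpace n) (r : Fin n → ℂ) (i k : Fin n) :
    tangentProj z (rowMatrix r) (i, k) =
      (1 / 2) * ((if i = 0 then r k else 0) - (∑ j, z (i, j) * star (r j)) * z (0, k)) := by
  have h1 : (toMatrix z * (toMatrix (rowMatrix r))ᴴ * toMatrix z) i k =
      (∑ j, z (i, j) * star (r j)) * z (0, k) := by
    rw [Matrix.mul_apply, Finset.sum_eq_single 0]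
    · simp [Matrix.mul_apply, rowMatrix_apply]
    · intro l _ hl
      simp [Matrix.mul_apply, rowMatrix_apply, hl]
    · simp
  rw [← toMatrix_apply, toMatrix_tangentProj, Matrix.smul_apply, Matrix.sub_apply, h1,
    Complex.real_smul, toMatrix_apply, rowMatrix_apply]
  push_cast
  rfl

theorem exists_tangent_of_normSq_lt {z : MatrixSpace n} (hz : z ∈ unitary n) {c : Fin n → ℂ}
    (hc : Complex.normSq (∑ k, c k * z (0, k)) < ∑ k, Complex.normSq (c k)) (ζ : ℂ) :
    ∃ u, hermForm n z u = 0 ∧ ∑ k, c k * u (0, k) = ζ := by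
  set s := ∑ k, c k * z (0, k) with hs
  set D : ℂ := (∑ k, c k * star (c k)) - s * star s with hD
  have hD0 : D ≠ 0 := by
    have h1 : D = ((∑ k, Complex.normSq (c k) - Complex.normSq s : ℝ) : ℂ) := by
      simp [hD, Complex.mul_conj]
    rw [h1]
    exact_mod_cast (sub_pos.2 hc).ne'
  have hrow := sum_mul_star_row hz
  -- The row is the part of `c̄` orthogonal to the first row of `z`, so the correction term of the
  -- projection vanishes there. The pairing of `c` with this part is `D`, and the factor 2 offsets
  -- the `1/2` of the projection.
  refine ⟨tangentProj z (rowMatrix fun k => 2 * ζ / D * (star (c k) - star s * z (0, k))),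
    hermForm_tangentProj hz _, ?_⟩
  have h1 : ∑ j, z (0, j) * star (2 * ζ / D * (star (c j) - star s * z (0, j))) = 0 := by
    calc _ = star (2 * ζ / D) * (∑ j, c j * z (0, j) - s * ∑ j, z (0, j) * star (z (0, j))) := by
          rw [Finset.mul_sum, ← Finset.sum_sub_distrib, Finset.mul_sum]
          refine Finset.sum_congr rfl fun j _ => ?_
          simp only [star_mul', star_sub, star_star]
          ring
      _ = 0 := by rw [hrow, ← hs, mul_one, sub_self, mul_zero]
  simp only [tangentProj_rowMatrix_apply, h1, if_true, zero_mul, sub_zero]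
  calc _ = ζ / D * (∑ k, c k * star (c k) - star s * ∑ k, c k * z (0, k)) := by
        rw [Finset.mul_sum, ← Finset.sum_sub_distrib, Finset.mul_sum]
        exact Finset.sum_congr rfl fun k _ => by ring
    _ = ζ := by
        rw [← hs, mul_comm (star s), ← hD, div_mul_cancel₀ _ hD0]

/-- A unit row cannot have all entries below `1/n`: the squares would then sum to less than one. The
bound is cruder than `1/√n` but avoids square roots. -/
theorem exists_le_norm_row {z : MatrixSpace n} (hz : z ∈ unitary n) :
    ∃ k, (1 / n : ℝ) ≤ ‖z (0, k)‖ := by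
  by_contra! h
  have hn : (0 : ℝ) < n := Nat.cast_pos.2 (NeZero.pos n)
  have hn1 : (1 / n : ℝ) ≤ 1 := by
    rw [div_le_one hn]
    exact_mod_cast NeZero.pos n
  have h1 : ∑ k, ‖z (0, k)‖ ^ 2 = 1 := by
    have h2 := sum_mul_star_row hz
    simp only [Complex.star_def, Complex.mul_conj, Complex.normSq_eq_norm_sq] at h2
    exact_mod_cast h2
  have h2 : ∑ k, ‖z (0, k)‖ ^ 2 < ∑ _k : Fin n, (1 / n : ℝ) := by
    refine Finset.sum_lt_sum_of_nonempty Finset.univ_nonempty fun k _ => ?_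
    have h3 := h k
    have h4 := norm_nonneg (z (0, k))
    nlinarith
  rw [h1, Finset.sum_const, Finset.card_univ, Fintype.card_fin, nsmul_eq_mul,
    mul_one_div_cancel hn.ne'] at h2
  exact lt_irrefl _ h2

/-- Near the zero fibre the differential of `Φ_a` on the unitary group is onto. -/
theorem exists_pos_forall_exists_tangent {d : ℕ} (hd : 0 < d) {a : Fin n → ℂ}
    (ha : a ∈ paramSet n) : ∃ ε : ℝ, 0 < ε ∧ ∀ z ∈ unitary n, ‖Phi d a z‖ < ε →
      ∀ ζ, ∃ u, hermForm n z u = 0 ∧ fderiv ℝ (Phi d a) z u = ζ := by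
  obtain ⟨k₀, hk₀⟩ := Finite.exists_min fun k => ‖a k‖
  have hn : (0 : ℝ) < n := Nat.cast_pos.2 (NeZero.pos n)
  -- With `ε = min |a_k| · n^{-(d-1)}`, an entry with `|z_1k| ≥ 1/n` gives `|d Φ_a| < |c_k|`, so one
  -- coordinate of the differential already dominates.
  have hε : 0 < ‖a k₀‖ * (1 / n : ℝ) ^ (d - 1) :=
    mul_pos (norm_pos_iff.2 (ha k₀)) (by positivity)
  refine ⟨_, hε, fun z hz hlt ζ => ?_⟩
  simp only [fderiv_Phi_apply]
  refine exists_tangent_of_normSq_lt hz ?_ ζ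
  obtain ⟨k, hk⟩ := exists_le_norm_row hz
  have hd' : (0 : ℝ) < d := Nat.cast_pos.2 hd
  rw [sum_phiCoeff_mul d hd]
  refine lt_of_lt_of_le ?_ (Finset.single_le_sum
    (fun k _ => Complex.normSq_nonneg (phiCoeff d a z k)) (Finset.mem_univ k))
  rw [Complex.normSq_eq_norm_sq, Complex.normSq_eq_norm_sq]
  refine pow_lt_pow_left₀ ?_ (norm_nonneg _) two_ne_zero
  rw [phiCoeff, norm_mul, norm_mul, norm_mul, Complex.norm_natCast, norm_pow]
  calc (d : ℝ) * ‖Phi d a z‖ < d * (‖a k₀‖ * (1 / n : ℝ) ^ (d - 1)) := by gcongr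
    _ ≤ d * (‖a k‖ * ‖z (0, k)‖ ^ (d - 1)) := by
        gcongr
        exact hk₀ k
    _ = _ := by ring

/-- On the zero fibre submersivity supplies the direction; elsewhere `i z` does, by homogeneity. -/
theorem exists_tangent_fderiv_Phi_ne_zero {d : ℕ} (hd : 0 < d) {a : Fin n → ℂ}
    (ha : a ∈ paramSet n) {z : MatrixSpace n} (hz : z ∈ unitary n) :
    ∃ u, hermForm n z u = 0 ∧ fderiv ℝ (Phi d a) z u ≠ 0 := by
  by_cases h0 : Phi d a z = 0
  · obtain ⟨ε, hε, h⟩ := exists_pos_forall_exists_tangent hd ha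
    obtain ⟨u, hu, hu'⟩ := h z hz (by rwa [h0, norm_zero]) 1
    exact ⟨u, hu, by rw [hu']; exact one_ne_zero⟩
  · refine ⟨_, hermForm_I_smul hz, ?_⟩
    have h1 : fderiv ℝ (Phi d a) z (Complex.I • z) = Complex.I * (d * Phi d a z) := by
      rw [fderiv_Phi_apply, ← sum_phiCoeff_mul d hd, Finset.mul_sum]
      refine Finset.sum_congr rfl fun k _ => ?_
      simp
      ring
    rw [h1]
    exact mul_ne_zero Complex.I_ne_zero (mul_ne_zero (Nat.cast_ne_zero.2 hd.ne') h0)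

theorem gradientNeZeroAt_Phi {d : ℕ} (hd : 0 < d) {a : Fin n → ℂ} (ha : a ∈ paramSet n)
    (z : MatrixSpace n) : GradientNeZeroAt (unitary n) (n ^ 2) (Phi d a) z := by
  rintro U ψ h x hx rfl h0
  obtain ⟨u, hu, hu'⟩ := exists_tangent_fderiv_Phi_ne_zero hd ha (h.mem hx)
  obtain ⟨y, rfl⟩ := h.mem_range_of_hermForm hx hu
  apply hu'
  -- Lowering the index of the gradient with the metric recovers the partial derivatives.
  have h1 : ∀ k, partialDeriv k (Phi d a ∘ ψ) x = 0 := by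
    intro k
    calc partialDeriv k (Phi d a ∘ ψ) x
        = ∑ i, ((if i = k then 1 else 0 : ℝ) : ℂ) * partialDeriv i (Phi d a ∘ ψ) x := by
          rw [Finset.sum_eq_single k] <;> simp +contextual
      _ = ∑ i, ∑ j, (metricMatrix ψ x j k : ℂ) *
            ((invMetric ψ x i j : ℂ) * partialDeriv i (Phi d a ∘ ψ) x) := by
          refine Finset.sum_congr rfl fun i _ => ?_
          rw [← h.sum_invMetric_mul hx i k, Complex.ofReal_sum, Finset.sum_mul]
          refine Finset.sum_congr rfl fun j _ => ?_
          rw [invMetric_symm]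
          push_cast
          ring
      _ = ∑ j, (metricMatrix ψ x j k : ℂ) * gradient ψ (Phi d a ∘ ψ) x j := by
          rw [Finset.sum_comm]
          exact Finset.sum_congr rfl fun j _ => by rw [gradient, Finset.mul_sum]
      _ = 0 := Finset.sum_eq_zero fun j _ => by rw [congrFun h0 j, Pi.zero_apply, mul_zero]
  have h2 := fderiv_comp x ((contDiff_Phi d a).differentiable (by simp) _)
    ((h.contDiffAt hx).differentiableAt (by simp))
  have h3 := DFunLike.congr_fun h2 y
  rw [fderiv_apply_eq_sum] at h3
  simpa [h1] using h3.symm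

theorem exists_isSubmersiveAt_Phi {d : ℕ} (hd : 0 < d) {a : Fin n → ℂ} (ha : a ∈ paramSet n) :
    ∃ ε : ℝ, 0 < ε ∧ ∀ z ∈ unitary n, ‖Phi d a z‖ < ε →
      IsSubmersiveAt (unitary n) (n ^ 2) (Phi d a) z := by
  obtain ⟨ε, hε, H⟩ := exists_pos_forall_exists_tangent hd ha
  refine ⟨ε, hε, fun z hz hlt => ?_⟩
  rintro U ψ h x hx rfl ζ
  obtain ⟨u, hu, rfl⟩ := H _ hz hlt ζ
  obtain ⟨y, rfl⟩ := h.mem_range_of_hermForm hx hu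
  refine ⟨y, ?_⟩
  rw [fderiv_comp x ((contDiff_Phi d a).differentiable (by simp) _)
    ((h.contDiffAt hx).differentiableAt (by simp))]
  rfl

/-- A unit vector extends to an orthonormal basis, whose members form the rows. -/
theorem exists_unitary_row {v : Fin n → ℂ} (hv : ∑ k, v k * star (v k) = 1) :
    ∃ z ∈ unitary n, ∀ k, z (0, k) = v k := by
  have hinner : ∀ u w : EuclideanSpace ℂ (Fin n), inner ℂ u w = ∑ k, w k * star (u k) := by
    intro u w
    simp [PiLp.inner_apply]
  have h1 : Orthonormal ℂ (Set.domRestrict ({0} : Set (Fin n))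
      fun _ : Fin n => (WithLp.toLp 2 v : EuclideanSpace ℂ (Fin n))) := by
    constructor
    · intro i
      rw [← sq_eq_sq₀ (norm_nonneg _) zero_le_one, one_pow]
      have h2 : inner ℂ (WithLp.toLp 2 v : EuclideanSpace ℂ (Fin n)) (WithLp.toLp 2 v) = 1 := by
        rw [hinner]
        exact hv
      have h3 : ‖(WithLp.toLp 2 v : EuclideanSpace ℂ (Fin n))‖ ^ 2 = 1 := by
        rw [← inner_self_eq_norm_sq (𝕜 := ℂ), h2, RCLike.one_re]
      exact h3
    · intro i j hij
      exact absurd (Subsingleton.elim i j) hij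
  obtain ⟨b, hb⟩ := h1.exists_orthonormalBasis_extension_of_card_eq (by simp)
  refine ⟨ofMatrix (Matrix.of fun i k => b i k), ?_, fun k => ?_⟩
  · refine Matrix.mem_unitaryGroup_iff.2 ?_
    ext i j
    rw [toMatrix_ofMatrix, Matrix.mul_apply, Matrix.one_apply]
    have h2 := orthonormal_iff_ite.1 b.orthonormal j i
    rw [hinner] at h2
    simp only [Matrix.star_apply, Matrix.of_apply]
    rw [h2]
    simp [eq_comm]
  · rw [ofMatrix_apply, Matrix.of_apply, hb 0 rfl]

/-- The values of all the functions `Φ_b` at a suitable unitary matrix. -/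
theorem exists_unitary_Phi_eq {d : ℕ} (hd : 0 < d) {w : Fin n → ℂ} (hw : w ≠ 0) :
    ∃ z ∈ unitary n, ∃ t : ℂ, t ≠ 0 ∧ ∀ b, Phi d b z = t * ∑ k, b k * w k := by
  -- The first row will be the vector of `d`-th roots divided by its norm `√S`, so that `t =
  -- (√S)^{-d}`.
  choose v hv using fun k => IsAlgClosed.exists_pow_nat_eq (w k) hd
  set S : ℝ := ∑ k, ‖v k‖ ^ 2 with hS
  have hS0 : 0 < S := by
    obtain ⟨k, hk⟩ := Function.ne_iff.1 hw
    have h1 : v k ≠ 0 := by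
      intro h
      exact hk (by rw [← hv k, h, zero_pow hd.ne']; rfl)
    exact Finset.sum_pos' (fun k _ => by positivity)
      ⟨k, Finset.mem_univ k, pow_pos (norm_pos_iff.2 h1) 2⟩
  have hT : (√S : ℂ) ≠ 0 := by exact_mod_cast (Real.sqrt_pos.2 hS0).ne'
  obtain ⟨z, hz, hzv⟩ := exists_unitary_row (v := fun k => (√S : ℂ)⁻¹ * v k) (by
    calc _ = (√S : ℂ)⁻¹ * (√S : ℂ)⁻¹ * ∑ k, v k * star (v k) := by
          rw [Finset.mul_sum]
          refine Finset.sum_congr rfl fun k _ => ?_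
          simp
          ring
      _ = (√S : ℂ)⁻¹ * (√S : ℂ)⁻¹ * S := by
          congr 1
          simp [Complex.mul_conj, Complex.normSq_eq_norm_sq, hS]
      _ = 1 := by
          have h1 : (S : ℂ) = √S * √S := by exact_mod_cast (Real.mul_self_sqrt hS0.le).symm
          rw [h1]
          field_simp)
  refine ⟨z, hz, ((√S : ℂ)⁻¹) ^ d, pow_ne_zero _ (inv_ne_zero hT), fun b => ?_⟩
  rw [Phi, Finset.mul_sum]
  refine Finset.sum_congr rfl fun k _ => ?_
  rw [toMatrix_apply, hzv, mul_pow, hv]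
  ring

theorem isCompact_zeroFibre (d : ℕ) (a : Fin n → ℂ) : IsCompact (zeroFibre d a) :=
  (isCompact_unitary n).inter_right
    (isClosed_singleton.preimage (contDiff_Phi d a).continuous : IsClosed (Phi d a ⁻¹' {0}))

theorem zeroFibre_eq_empty {d : ℕ} (hn : n = 1) {a : Fin n → ℂ} (ha : a ∈ paramSet n) :
    zeroFibre d a = ∅ := by
  subst hn
  refine Set.eq_empty_of_forall_notMem fun z ⟨hz, h0⟩ => ?_
  have h1 := sum_mul_star_row hz
  rw [Phi, Fin.sum_univ_one] at h0
  rw [Fin.sum_univ_one] at h1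
  refine mul_ne_zero (ha 0) (pow_ne_zero d fun h => ?_) h0
  rw [toMatrix_apply] at h
  rw [h, zero_mul] at h1
  exact zero_ne_one h1

theorem eq_of_Phi_eq {d : ℕ} (hd : 0 < d) {a b : Fin n → ℂ}
    (h : ∀ z ∈ unitary n, Phi d a z = Phi d b z) : a = b := by
  funext k
  obtain ⟨z, hz, t, ht, H⟩ := exists_unitary_Phi_eq hd
    (w := Pi.single k (1 : ℂ)) (by simp)
  have h1 := h z hz
  rw [H, H] at h1
  simpa [Pi.single_apply] using mul_left_cancel₀ ht h1

/-- The vector `e_k / a_k - e_l / a_l` is annihilated by `a`. Another `Φ_b` vanishes at the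
resulting point only if `b_k / a_k = b_l / a_l`, which is how the fibre determines the ratios of the
parameters. -/
theorem exists_mem_zeroFibre {d : ℕ} (hd : 0 < d) {a : Fin n → ℂ} (ha : a ∈ paramSet n)
    {k l : Fin n} (hkl : k ≠ l) : ∃ z ∈ zeroFibre d a, ∃ t : ℂ, t ≠ 0 ∧
      ∀ b, Phi d b z = t * (b k * (a k)⁻¹ - b l * (a l)⁻¹) := by
  have hw : (Pi.single k (a k)⁻¹ - Pi.single l (a l)⁻¹ : Fin n → ℂ) ≠ 0 := fun h => by
    have h1 := congrFun h k
    simp [hkl, ha k] at h1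
  obtain ⟨z, hz, t, ht, H⟩ := exists_unitary_Phi_eq hd hw
  have H' : ∀ b, Phi d b z = t * (b k * (a k)⁻¹ - b l * (a l)⁻¹) := fun b => by
    rw [H]
    simp [mul_sub, Pi.single_apply, Finset.sum_sub_distrib]
  exact ⟨z, ⟨hz, by rw [H', mul_inv_cancel₀ (ha k), mul_inv_cancel₀ (ha l), sub_self, mul_zero]⟩,
    t, ht, H'⟩

theorem zeroFibre_nonempty {d : ℕ} (hd : 0 < d) (hn : 2 ≤ n) {a : Fin n → ℂ}
    (ha : a ∈ paramSet n) : (zeroFibre d a).Nonempty := by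
  obtain ⟨z, hz, -⟩ := exists_mem_zeroFibre hd ha
    (k := ⟨0, by omega⟩) (l := ⟨1, by omega⟩) (by simp)
  exact ⟨z, hz⟩

theorem zeroFibre_eq_iff {d : ℕ} (hd : 0 < d) {a b : Fin n → ℂ}
    (ha : a ∈ paramSet n) (hb : b ∈ paramSet n) :
    zeroFibre d a = zeroFibre d b ↔ ∃ c : ℂ, c ≠ 0 ∧ b = c • a := by
  constructor
  · intro h
    refine ⟨b 0 * (a 0)⁻¹, mul_ne_zero (hb 0) (inv_ne_zero (ha 0)), ?_⟩
    funext k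
    rw [Pi.smul_apply, smul_eq_mul]
    rcases eq_or_ne k 0 with rfl | hk
    · rw [inv_mul_cancel_right₀ (ha 0)]
    · obtain ⟨z, hz, t, ht, H⟩ := exists_mem_zeroFibre hd ha hk
      rw [h] at hz
      have h1 := hz.2
      rw [H, mul_eq_zero, or_iff_right ht, sub_eq_zero] at h1
      rw [← h1, inv_mul_cancel_right₀ (ha k)]
  · rintro ⟨c, hc, rfl⟩
    ext z
    have h1 : Phi d (c • a) z = c * Phi d a z := by
      simp [Phi, Finset.mul_sum, mul_assoc]
    simp [zeroFibre, h1, hc]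

end FirstRow

/-! ### Tangent spaces by curves, and a criterion for zero mean curvature -/

section TangentSpace

variable {E : Type*} [NormedAddCommGroup E] [InnerProductSpace ℝ E]
  {F : Type*} [NormedAddCommGroup F] [NormedSpace ℝ F]
  {M : Set E} {m : ℕ} {U : Set (EuclideanSpace ℝ (Fin m))} {ψ : EuclideanSpace ℝ (Fin m) → E}
  {x : EuclideanSpace ℝ (Fin m)}

/-- This upper bound is applied to `U(n)`, and the lower bound
`IsLocalParam.range_le_tangentSpaceAt` to the fibre. Together they control the normal space without
computing either tangent space exactly. -/
theorem tangentSpaceAt_le_ker {f : E → F} {p : E} (hf : DifferentiableAt ℝ f p) {c : F}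
    (hc : ∀ q ∈ M, f q = c) : tangentSpaceAt M p ≤ LinearMap.ker (fderiv ℝ f p).toLinearMap := by
  refine Submodule.span_le.2 ?_
  rintro v ⟨γ, -, hγM, rfl, hγ⟩
  have h1 : HasDerivAt (f ∘ γ) (fderiv ℝ f (γ 0) v) 0 :=
    hf.hasFDerivAt.comp_hasDerivAt 0 hγ
  have h2 : f ∘ γ =ᶠ[𝓝 0] fun _ => c := hγM.mono fun t ht => hc _ ht
  exact h1.unique ((hasDerivAt_const 0 c).congr_of_eventuallyEq h2)

theorem IsLocalParam.range_le_tangentSpaceAt (h : IsLocalParam M m U ψ) (hx : x ∈ U) :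
    LinearMap.range (fderiv ℝ ψ x).toLinearMap ≤ tangentSpaceAt M (ψ x) := by
  rintro _ ⟨u, rfl⟩
  have h0 : x + (0 : ℝ) • u = x := by simp
  have hline : HasDerivAt (fun t : ℝ => x + t • u) u 0 := by
    simpa using ((hasDerivAt_id (0 : ℝ)).smul_const u).const_add x
  refine Submodule.subset_span ⟨fun t => ψ (x + t • u), ?_, ?_, by simp, ?_⟩
  · exact ContDiffAt.comp (0 : ℝ) (g := ψ) (by rw [h0]; exact h.contDiffAt hx) (by fun_prop)
  · have h1 : Filter.Tendsto (fun t : ℝ => x + t • u) (𝓝 0) (𝓝 x) := by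
      simpa [ContinuousAt] using hline.continuousAt
    exact h1.eventually (h.eventually_mem hx)
  · have h1 : HasFDerivAt ψ (fderiv ℝ ψ x) (x + (0 : ℝ) • u) := by
      rw [h0]
      exact ((h.contDiffAt hx).differentiableAt (by simp)).hasFDerivAt
    exact h1.comp_hasDerivAt (0 : ℝ) hline

/-- The mean curvature vector vanishes if the contracted second derivatives of a parametrisation
are orthogonal to the normal space. -/
theorem meanCurvature_eq_zero [FiniteDimensional ℝ E] {K M : Set E}
    (h : ∀ v ∈ normalSpaceAt K M (ψ x), inner ℝ v
      (∑ i, ∑ j, invMetric ψ x i j • partialDeriv i (partialDeriv j ψ) x) = 0) :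
    meanCurvature K M ψ x = 0 := by
  have h1 : ∑ i, ∑ j, invMetric ψ x i j • secondFundamentalForm K M ψ x i j =
      (normalSpaceAt K M (ψ x)).starProjection
        (∑ i, ∑ j, invMetric ψ x i j • partialDeriv i (partialDeriv j ψ) x) := by
    simp only [map_sum, map_smul]
    rfl
  rw [meanCurvature, h1, (Submodule.starProjection_apply_eq_zero_iff _).2
    ((Submodule.mem_orthogonal _ _).2 h), smul_zero]

end TangentSpace

/-! ### The zero fibre: regularity and tangential projection -/

section Fibre

variable {n : ℕ} [NeZero n] {d : ℕ} {a : Fin n → ℂ}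

/-- The fibre is the level set of this map. -/
def fibreMap (d : ℕ) (a : Fin n → ℂ) (z : MatrixSpace n) : hermitian n × ℂ :=
  (hermForm n z z, Phi d a z)

theorem contDiff_fibreMap (d : ℕ) (a : Fin n → ℂ) : ContDiff ℝ ∞ (fibreMap d a) :=
  (contDiff_quadratic (hermForm n)).prodMk (contDiff_Phi d a)

theorem mem_zeroFibre_iff {z : MatrixSpace n} :
    z ∈ zeroFibre d a ↔ fibreMap d a z = (hermTwo n, 0) := by
  rw [fibreMap, Prod.mk.injEq, ← mem_unitary_iff]
  rfl

theorem fderiv_fibreMap_apply (z u : MatrixSpace n) :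
    fderiv ℝ (fibreMap d a) z u = ((2 : ℝ) • hermForm n z u, fderiv ℝ (Phi d a) z u) := by
  have h1 : HasFDerivAt (fibreMap d a) _ z :=
    ((contDiff_quadratic (hermForm n)).differentiable (by simp) z).hasFDerivAt.prodMk
      ((contDiff_Phi d a).differentiable (by simp) z).hasFDerivAt
  rw [h1.fderiv, ← fderiv_hermForm_apply]
  rfl

/-- Any vector with the right Hermitian component can be corrected by a vector tangent to `U(n)`,
which changes only the `Φ_a` component. -/
theorem surjective_fderiv_fibreMap (hd : 0 < d) (ha : a ∈ paramSet n) {z : MatrixSpace n}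
    (hz : z ∈ zeroFibre d a) : Function.Surjective (fderiv ℝ (fibreMap d a) z) := by
  rintro ⟨h, ζ⟩
  obtain ⟨u, hu⟩ := surjective_fderiv_hermForm hz.1 h
  rw [fderiv_hermForm_apply] at hu
  obtain ⟨ε, hε, H⟩ := exists_pos_forall_exists_tangent hd ha
  obtain ⟨t, ht, ht'⟩ := H z hz.1 (by rwa [hz.2, norm_zero]) (ζ - fderiv ℝ (Phi d a) z u)
  refine ⟨u + t, ?_⟩
  rw [fderiv_fibreMap_apply, map_add, map_add, ht, ht', add_zero, hu, add_sub_cancel]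

theorem finrank_hermitian_prod :
    Module.finrank ℝ (hermitian n × ℂ) = n ^ 2 + 2 := by
  rw [Module.finrank_prod, finrank_hermitian, Complex.finrank_real_complex]

variable {m : ℕ} {U : Set (EuclideanSpace ℝ (Fin m))} {ψ : EuclideanSpace ℝ (Fin m) → MatrixSpace n}
  {x : EuclideanSpace ℝ (Fin m)}

theorem isSubmanifold_zeroFibre (hd : 0 < d) (ha : a ∈ paramSet n) (hm : m + 2 = n ^ 2) :
    IsSubmanifold (zeroFibre d a) m :=
  isSubmanifold_of_regular (contDiff_fibreMap d a) (fun _ => mem_zeroFibre_iff)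
    (fun _ hp => surjective_fderiv_fibreMap hd ha hp)
    (by rw [finrank_matrixSpace, finrank_hermitian_prod]; omega)

theorem IsLocalParam.mem_range_zeroFibre_iff (hd : 0 < d) (ha : a ∈ paramSet n)
    (hm : m + 2 = n ^ 2) (h : IsLocalParam (zeroFibre d a) m U ψ) (hx : x ∈ U)
    {u : MatrixSpace n} : u ∈ LinearMap.range (fderiv ℝ ψ x).toLinearMap ↔
      hermForm n (ψ x) u = 0 ∧ fderiv ℝ (Phi d a) (ψ x) u = 0 := by
  rw [h.range_fderiv_eq_ker hx (contDiff_fibreMap d a) (fun p => mem_zeroFibre_iff.1)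
    (surjective_fderiv_fibreMap hd ha (h.mem hx))
    (by rw [finrank_matrixSpace, finrank_hermitian_prod]; omega)]
  rw [LinearMap.mem_ker, ContinuousLinearMap.coe_coe, fderiv_fibreMap_apply, Prod.mk_eq_zero,
    smul_eq_zero, or_iff_right two_ne_zero]

/-- The tangential projection of a row matrix, orthogonally a multiple of a gradient of `Φ_a`. -/
def phiNormal (d : ℕ) (a : Fin n → ℂ) (z : MatrixSpace n) (c : ℂ) : MatrixSpace n :=
  tangentProj z (rowMatrix fun k => c * star (phiCoeff d a z k))

/-- The squared length of the differential of `Φ_a` in the ambient space. -/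
def phiNormSq (d : ℕ) (a : Fin n → ℂ) (z : MatrixSpace n) : ℝ :=
  ∑ k, Complex.normSq (phiCoeff d a z k)

theorem sum_phiCoeff_mul_star (z : MatrixSpace n) :
    ∑ k, phiCoeff d a z k * star (phiCoeff d a z k) = phiNormSq d a z := by
  simp [phiNormSq, Complex.mul_conj]

theorem phiNormSq_ne_zero (hd : 0 < d) (ha : a ∈ paramSet n) {z : MatrixSpace n}
    (hz : z ∈ unitary n) : phiNormSq d a z ≠ 0 := by
  obtain ⟨u, -, hu⟩ := exists_tangent_fderiv_Phi_ne_zero hd ha hz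
  intro h
  apply hu
  rw [fderiv_Phi_apply]
  refine Finset.sum_eq_zero fun k hk => ?_
  rw [Complex.normSq_eq_zero.1 ((Finset.sum_eq_zero_iff_of_nonneg
    fun k _ => Complex.normSq_nonneg _).1 h k hk), zero_mul]

theorem phiNormal_apply (z : MatrixSpace n) (c : ℂ) (i k : Fin n) :
    phiNormal d a z c (i, k) = (1 / 2) * ((if i = 0 then c * star (phiCoeff d a z k) else 0) -
      star c * (∑ j, z (i, j) * phiCoeff d a z j) * z (0, k)) := by
  rw [phiNormal, tangentProj_rowMatrix_apply, Finset.mul_sum]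
  congr 4
  funext j
  simp
  ring

/-- The correction term of the projection carries the Euler sum `d Φ_a`, zero on the fibre. The
first row is therefore complex linear in `c`. -/
theorem phiNormal_apply_zero (hd : 0 < d) {z : MatrixSpace n} (hz : z ∈ zeroFibre d a) (c : ℂ)
    (k : Fin n) : phiNormal d a z c (0, k) = (1 / 2) * (c * star (phiCoeff d a z k)) := by
  have h1 : ∑ j, z (0, j) * phiCoeff d a z j = 0 := by
    simp only [mul_comm (z _)]
    rw [sum_phiCoeff_mul d hd, hz.2, mul_zero]
  rw [phiNormal_apply, h1]
  simp

theorem fderiv_Phi_phiNormal (hd : 0 < d) {z : MatrixSpace n} (hz : z ∈ zeroFibre d a) (c : ℂ) :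
    fderiv ℝ (Phi d a) z (phiNormal d a z c) = (1 / 2) * c * phiNormSq d a z := by
  rw [fderiv_Phi_apply, ← sum_phiCoeff_mul_star, Finset.mul_sum]
  refine Finset.sum_congr rfl fun k _ => ?_
  rw [phiNormal_apply_zero hd hz]
  ring

theorem inner_rowMatrix (u : MatrixSpace n) (r : Fin n → ℂ) :
    inner ℝ u (rowMatrix r) = (∑ k, u (0, k) * star (r k)).re := by
  rw [inner_eq_trace, Matrix.trace, Complex.re_sum, Complex.re_sum, Finset.sum_eq_single 0]
  · simp [Matrix.mul_apply, rowMatrix_apply]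
  · intro i _ hi
    simp [Matrix.mul_apply, rowMatrix_apply, hi]
  · simp

/-- On tangent vectors `phiNormal` represents the real functional `Re(c̄ dΦ_a)`. Hence the vectors
for `c = 1` and `c = i` are orthogonal to the fibre. -/
theorem inner_phiNormal {z t : MatrixSpace n} (hz : z ∈ unitary n) (ht : hermForm n z t = 0)
    (c : ℂ) : inner ℝ t (phiNormal d a z c) = (star c * fderiv ℝ (Phi d a) z t).re := by
  have h1 := inner_sub_tangentProj hz ht (rowMatrix fun k => c * star (phiCoeff d a z k))
  rw [inner_sub_right, sub_eq_zero] at h1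
  rw [phiNormal, ← h1, inner_rowMatrix, fderiv_Phi_apply, Finset.mul_sum]
  congr 1
  refine Finset.sum_congr rfl fun k _ => ?_
  simp
  ring

theorem inner_phiNormal_left {z : MatrixSpace n} (hz : z ∈ unitary n) (w : MatrixSpace n) (c : ℂ) :
    inner ℝ (phiNormal d a z c) w =
      (star c * fderiv ℝ (Phi d a) z (tangentProj z w)).re := by
  have h1 := inner_sub_tangentProj hz (hermForm_tangentProj hz
    (rowMatrix fun k => c * star (phiCoeff d a z k))) w
  rw [inner_sub_right, sub_eq_zero] at h1
  rw [phiNormal, h1, real_inner_comm]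
  exact inner_phiNormal hz (hermForm_tangentProj hz w) c

/-- The tangential projection of the fibre. -/
def fibreProj (d : ℕ) (a : Fin n → ℂ) (z w : MatrixSpace n) : MatrixSpace n :=
  tangentProj z w - (2 / phiNormSq d a z) •
    (inner ℝ (phiNormal d a z 1) w • phiNormal d a z 1 +
      inner ℝ (phiNormal d a z Complex.I) w • phiNormal d a z Complex.I)

theorem hermForm_fibreProj {z : MatrixSpace n} (hz : z ∈ unitary n) (w : MatrixSpace n) :
    hermForm n z (fibreProj d a z w) = 0 := by
  simp only [fibreProj, phiNormal, map_sub, map_add, map_smul, hermForm_tangentProj hz, smul_zero,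
    add_zero, sub_zero]

/-- The two inner products are the real and imaginary parts of `D = dΦ_a(Pw)`, with `P` the
projection for `U(n)`. The weight `2 / phiNormSq` turns the correction into exactly `D`. -/
theorem fderiv_Phi_fibreProj (hd : 0 < d) (ha : a ∈ paramSet n) {z : MatrixSpace n}
    (hz : z ∈ zeroFibre d a) (w : MatrixSpace n) :
    fderiv ℝ (Phi d a) z (fibreProj d a z w) = 0 := by
  have hC : (phiNormSq d a z : ℂ) ≠ 0 := by exact_mod_cast phiNormSq_ne_zero hd ha hz.1
  rw [fibreProj, map_sub, map_smul, map_add, map_smul, map_smul, fderiv_Phi_phiNormal hd hz,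
    fderiv_Phi_phiNormal hd hz, inner_phiNormal_left hz.1, inner_phiNormal_left hz.1]
  set D := fderiv ℝ (Phi d a) z (tangentProj z w)
  have hD := Complex.re_add_im D
  simp
  field_simp
  linear_combination -hD

theorem inner_sub_fibreProj {z t : MatrixSpace n} (hz : z ∈ unitary n)
    (ht : hermForm n z t = 0) (ht' : fderiv ℝ (Phi d a) z t = 0) (w : MatrixSpace n) :
    inner ℝ t (w - fibreProj d a z w) = 0 := by
  rw [fibreProj, sub_sub_eq_add_sub, add_sub_right_comm, inner_add_right,
    inner_sub_tangentProj hz ht, inner_smul_right, inner_add_right, inner_smul_right,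
    inner_smul_right, inner_phiNormal hz ht, inner_phiNormal hz ht, ht']
  simp

theorem fibreProj_single_one (z : MatrixSpace n) (p q : Fin n × Fin n) :
    fibreProj d a z (EuclideanSpace.single p 1) q = tangentProj z (EuclideanSpace.single p 1) q -
      (2 / phiNormSq d a z : ℝ) * ((phiNormal d a z 1 p).re * phiNormal d a z 1 q +
        (phiNormal d a z Complex.I p).re * phiNormal d a z Complex.I q) := by
  rw [fibreProj, inner_single_one, inner_single_one]
  simp [mul_add]

theorem fibreProj_single_I (z : MatrixSpace n) (p q : Fin n × Fin n) :
    fibreProj d a z (EuclideanSpace.single p Complex.I) q =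
      tangentProj z (EuclideanSpace.single p Complex.I) q -
      (2 / phiNormSq d a z : ℝ) * ((phiNormal d a z 1 p).im * phiNormal d a z 1 q +
        (phiNormal d a z Complex.I p).im * phiNormal d a z Complex.I q) := by
  rw [fibreProj, inner_single_I, inner_single_I]
  simp [mul_add]

/-- The normals contribute `ν² + (iν)² = 0`, so the trace is the same as on the whole unitary group.
-/
theorem fibreProj_single_add (hd : 0 < d) {z : MatrixSpace n} (hz : z ∈ zeroFibre d a)
    (k : Fin n) :
    fibreProj d a z (EuclideanSpace.single (0, k) 1) (0, k) +
      fibreProj d a z (EuclideanSpace.single (0, k) Complex.I) (0, k) * Complex.I =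
      -(z (0, k) * z (0, k)) := by
  have h1 := tangentProj_single_add z 0 k 0 k
  have h2 := Complex.re_add_im (phiNormal d a z 1 (0, k))
  have h3 := Complex.re_add_im (phiNormal d a z Complex.I (0, k))
  have h4 : phiNormal d a z Complex.I (0, k) = Complex.I * phiNormal d a z 1 (0, k) := by
    rw [phiNormal_apply_zero hd hz, phiNormal_apply_zero hd hz]
    ring
  rw [fibreProj_single_one, fibreProj_single_I]
  set s : ℂ := ((2 / phiNormSq d a z : ℝ) : ℂ)
  set ν := phiNormal d a z 1 (0, k)
  set ν' := phiNormal d a z Complex.I (0, k)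
  linear_combination h1 - s * ν * h2 - s * ν' * h3 - s * (ν' + Complex.I * ν) * h4 -
    s * ν ^ 2 * Complex.I_sq

theorem fibreProj_single_sub (hd : 0 < d) {z : MatrixSpace n} (hz : z ∈ zeroFibre d a)
    (i k : Fin n) :
    fibreProj d a z (EuclideanSpace.single (i, k) 1) (0, k) -
      fibreProj d a z (EuclideanSpace.single (i, k) Complex.I) (0, k) * Complex.I =
      (if 0 = i then 1 else 0) - (2 / phiNormSq d a z : ℝ) * (1 / 2) *
        (if i = 0 then phiCoeff d a z k * star (phiCoeff d a z k) else 0) := by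
  have h1 := tangentProj_single_sub z 0 k i k
  have hstar : ∀ w : ℂ, star w = w.re - w.im * Complex.I := fun w => by
    apply Complex.ext <;> simp
  have h2 := hstar (phiNormal d a z 1 (i, k))
  have h3 := hstar (phiNormal d a z Complex.I (i, k))
  have h4 : phiNormal d a z Complex.I (0, k) = Complex.I * phiNormal d a z 1 (0, k) := by
    rw [phiNormal_apply_zero hd hz, phiNormal_apply_zero hd hz]
    ring
  have h5 : phiNormal d a z 1 (0, k) = (1 / 2) * star (phiCoeff d a z k) := by
    rw [phiNormal_apply_zero hd hz, one_mul]
  -- The combination doubles the part of the normal that is linear in `c` and kills the antilinear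
  -- part, which is all there is in rows other than the first.
  have h6 : star (phiNormal d a z 1 (i, k)) + Complex.I * star (phiNormal d a z Complex.I (i, k)) =
      if i = 0 then phiCoeff d a z k else 0 := by
    rw [phiNormal_apply, phiNormal_apply]
    split_ifs
    · simp
      ring_nf
      simp
      ring
    · simp
      ring_nf
      simp
  have h7 : phiNormal d a z 1 (0, k) * (star (phiNormal d a z 1 (i, k)) +
      Complex.I * star (phiNormal d a z Complex.I (i, k))) =
      (1 / 2) * (if i = 0 then phiCoeff d a z k * star (phiCoeff d a z k) else 0) := by
    rw [h6, h5]
    split_ifs <;> ring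
  simp only [and_true] at h1
  rw [fibreProj_single_one, fibreProj_single_I, mul_assoc _ (1 / 2 : ℂ), ← h7]
  set s : ℂ := ((2 / phiNormSq d a z : ℝ) : ℂ)
  set ν := phiNormal d a z 1 (0, k)
  set ν' := phiNormal d a z Complex.I (0, k)
  linear_combination h1 + s * ν * h2 + s * ν' * h3 -
    s * star (phiNormal d a z Complex.I (i, k)) * h4

end Fibre

/-! ### Minimality of the zero fibre -/

section Minimality

variable {n : ℕ}

/-- Hermitian multiples of a unitary matrix are normal to the unitary group. -/
theorem inner_hermitian_mul (h : hermitian n) {z v : MatrixSpace n} (hv : hermForm n z v = 0) :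
    inner ℝ v (ofMatrix (toMatrix (h : MatrixSpace n) * toMatrix z)) = 0 := by
  have h1 := mem_hermitian.1 h.2
  set H := toMatrix (h : MatrixSpace n)
  have h2 : toMatrix v * (toMatrix z)ᴴ = -(toMatrix z * (toMatrix v)ᴴ) :=
    eq_neg_of_add_eq_zero_right (hermForm_eq_zero_iff.1 hv)
  have h3 : (toMatrix v * (H * toMatrix z)ᴴ).trace.re =
      ((toMatrix z * (toMatrix v)ᴴ) * H).trace.re := by
    rw [← Complex.conj_re, ← Complex.star_def, ← Matrix.trace_conjTranspose,
      Matrix.conjTranspose_mul, Matrix.conjTranspose_conjTranspose, Matrix.mul_assoc,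
      Matrix.trace_mul_comm]
  have h4 : (toMatrix v * (H * toMatrix z)ᴴ).trace.re =
      -((toMatrix z * (toMatrix v)ᴴ) * H).trace.re := by
    rw [Matrix.conjTranspose_mul, h1, ← Matrix.mul_assoc, h2, Matrix.neg_mul, Matrix.trace_neg,
      Complex.neg_re]
  rw [inner_eq_trace, toMatrix_ofMatrix]
  linarith

variable [NeZero n] {d : ℕ} {a : Fin n → ℂ} {m : ℕ} {U : Set (EuclideanSpace ℝ (Fin m))}
  {ψ : EuclideanSpace ℝ (Fin m) → MatrixSpace n} {x : EuclideanSpace ℝ (Fin m)}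

theorem zeroFibre_subset (d : ℕ) (a : Fin n → ℂ) : zeroFibre d a ⊆ unitary n := fun _ hz => hz.1

theorem IsLocalParam.sum_invMetric_smul_zeroFibre (hd : 0 < d) (ha : a ∈ paramSet n)
    (hm : m + 2 = n ^ 2) (h : IsLocalParam (zeroFibre d a) m U ψ) (hx : x ∈ U)
    (w : MatrixSpace n) :
    ∑ i, ∑ j, (invMetric ψ x i j * inner ℝ (partialDeriv j ψ x) w) • partialDeriv i ψ x =
      fibreProj d a (ψ x) w := by
  have hz := h.mem hx
  refine h.sum_invMetric_smul hx ?_ fun u => ?_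
  · exact (h.mem_range_zeroFibre_iff hd ha hm hx).2
      ⟨hermForm_fibreProj hz.1 w, fderiv_Phi_fibreProj hd ha hz w⟩
  · obtain ⟨h1, h2⟩ := (h.mem_range_zeroFibre_iff hd ha hm hx).1 ⟨u, rfl⟩
    exact inner_sub_fibreProj hz.1 h1 h2 w

/-- The metric trace over the fibre of the second derivative of `Φ_a` vanishes. -/
theorem IsLocalParam.sum_fderiv_fderiv_Phi (hd : 0 < d) (ha : a ∈ paramSet n)
    (hm : m + 2 = n ^ 2) (h : IsLocalParam (zeroFibre d a) m U ψ) (hx : x ∈ U) :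
    ∑ i, ∑ j, invMetric ψ x i j • fderiv ℝ (fderiv ℝ (Phi d a)) (ψ x) (partialDeriv i ψ x)
      (partialDeriv j ψ x) = 0 := by
  have hz := h.mem hx
  have h1 : ∀ k, ∑ i, ∑ j, invMetric ψ x i j •
      (partialDeriv i ψ x (0, k) * partialDeriv j ψ x (0, k)) = -(ψ x (0, k) * ψ x (0, k)) :=
    fun k => (sum_invMetric_mul_coord (h.sum_invMetric_smul_zeroFibre hd ha hm hx)
      (entry (0, k)) (0, k)).trans (fibreProj_single_add hd hz k)
  simp only [fderiv_fderiv_Phi_apply]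
  rw [sum_smul_sum_mul, Finset.sum_congr rfl fun k _ => congrArg _ (h1 k)]
  simp only [mul_neg, Finset.sum_neg_distrib, sum_phiCoeff_deriv_mul, hz.2, mul_zero, neg_zero]

/-- The first row of the trace of `∂ψ (∂ψ)*` over the fibre. -/
theorem IsLocalParam.toMatrix_sum_hermForm_zeroFibre (hd : 0 < d) (ha : a ∈ paramSet n)
    (hm : m + 2 = n ^ 2) (h : IsLocalParam (zeroFibre d a) m U ψ) (hx : x ∈ U) (k : Fin n) :
    toMatrix ((∑ s, ∑ t, invMetric ψ x s t • hermForm n (partialDeriv s ψ x)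
      (partialDeriv t ψ x) : hermitian n) : MatrixSpace n) 0 k =
      2 * if 0 = k then (n - 1 : ℂ) else 0 := by
  have hz := h.mem hx
  have hC : (phiNormSq d a (ψ x) : ℂ) ≠ 0 := by exact_mod_cast phiNormSq_ne_zero hd ha hz.1
  rw [toMatrix_sum_hermForm]
  congr 1
  have h1 : ∀ l, ∑ s, ∑ t, invMetric ψ x s t •
      (partialDeriv s ψ x (0, l) * star (partialDeriv t ψ x (k, l))) = _ := fun l =>
    (sum_invMetric_mul_star_coord (h.sum_invMetric_smul_zeroFibre hd ha hm hx)
      (entry (0, l)) (k, l)).trans (fibreProj_single_sub hd hz k l)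
  -- On the diagonal the Kronecker terms add up to `n`, and the normal terms to `phiNormSq /
  -- phiNormSq = 1`.
  rw [Finset.sum_congr rfl fun l _ => h1 l, Finset.sum_sub_distrib, ← Finset.mul_sum]
  rcases eq_or_ne k 0 with rfl | hk
  · simp only [if_true]
    rw [sum_phiCoeff_mul_star]
    push_cast
    field_simp
    simp
  · simp [hk, hk.symm]

theorem isMinimalSubmanifold_zeroFibre (hd : 0 < d) (hn : 2 ≤ n) (ha : a ∈ paramSet n) :
    IsMinimalSubmanifold (zeroFibre d a) (unitary n) 2 := by
  have hm : n ^ 2 - 2 + 2 = n ^ 2 := Nat.sub_add_cancel (by nlinarith)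
  refine ⟨zeroFibre_subset d a, n ^ 2 - 2, by rw [hm]; exact isSubmanifold_unitary n,
    isSubmanifold_zeroFibre hd ha hm, fun U ψ h x hx => meanCurvature_eq_zero fun v hv => ?_⟩
  have hz := h.mem hx
  obtain ⟨hvM, hvK⟩ := Submodule.mem_inf.1 hv
  have hvz : hermForm n (ψ x) v = 0 := by
    have h1 : fderiv ℝ (fun z => hermForm n z z) (ψ x) v = 0 :=
      tangentSpaceAt_le_ker ((contDiff_quadratic (hermForm n)).differentiable (by simp) _)
        (fun q => mem_unitary_iff.1) hvM
    rw [fderiv_hermForm_apply] at h1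
    exact (smul_eq_zero.1 h1).resolve_left two_ne_zero
  set L := ∑ i, ∑ j, invMetric ψ x i j • partialDeriv i (partialDeriv j ψ) x
  have hL1 := h.hermForm_sum_partialDeriv (zeroFibre_subset d a) hx
  have hA0 := h.toMatrix_sum_hermForm_zeroFibre hd ha hm hx
  have hL2 := h.sum_fderiv_fderiv_add hx (contDiff_Phi d a) (fun q hq => hq.2) (invMetric ψ x)
  rw [h.sum_fderiv_fderiv_Phi hd ha hm hx, zero_add] at hL2
  set A := ∑ i, ∑ j, invMetric ψ x i j • hermForm n (partialDeriv i ψ x) (partialDeriv j ψ x)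
  -- `N = A z` is normal to `U(n)`, and half of it compensates the Hermitian constraint violated by
  -- `L`.
  set N := ofMatrix (toMatrix (A : MatrixSpace n) * toMatrix (ψ x)) with hN
  have hN1 : hermForm n (ψ x) ((1 / 2 : ℝ) • N) = A := by
    have h1 := hermForm_smul_mul A hz.1
    rw [map_smul] at h1 ⊢
    calc (1 / 2 : ℝ) • hermForm n (ψ x) N = (2 : ℝ) • (1 / 4 : ℝ) • hermForm n (ψ x) N := by
          rw [smul_smul]
          norm_num
      _ = A := by
          rw [hN, h1, smul_smul]
          norm_num
  -- The first row of `N` is a multiple of that of `z`, so Euler's identity reduces the derivative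
  -- to a multiple of `Φ_a = 0`.
  have hN2 : fderiv ℝ (Phi d a) (ψ x) N = 0 := by
    have h1 : ∀ k, N (0, k) = 2 * (n - 1 : ℂ) * ψ x (0, k) := fun k => by
      rw [hN, ofMatrix_apply, Matrix.mul_apply]
      simp only [hA0]
      rw [Finset.sum_eq_single 0] <;> simp +contextual [eq_comm]
    calc _ = 2 * (n - 1 : ℂ) * ∑ k, phiCoeff d a (ψ x) k * ψ x (0, k) := by
          rw [fderiv_Phi_apply, Finset.mul_sum]
          exact Finset.sum_congr rfl fun k _ => by rw [h1]; ring
      _ = 0 := by rw [sum_phiCoeff_mul d hd, hz.2, mul_zero, mul_zero]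
  -- Being tangent to the fibre, this sum is orthogonal to `v`. As `N` is too, so is `L`.
  have hT : L + (1 / 2 : ℝ) • N ∈ LinearMap.range (fderiv ℝ ψ x).toLinearMap := by
    refine (h.mem_range_zeroFibre_iff hd ha hm hx).2 ⟨?_, ?_⟩
    · rw [map_add, hL1, hN1, neg_add_cancel]
    · rw [map_add, hL2, map_smul, hN2, smul_zero, add_zero]
  have h1 : inner ℝ v (L + (1 / 2 : ℝ) • N) = 0 :=
    Submodule.inner_left_of_mem_orthogonal (h.range_le_tangentSpaceAt hx hT) hvK
  rwa [inner_add_right, inner_smul_right, inner_hermitian_mul A hvz, mul_zero, add_zero] at h1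

end Minimality

end MinimalFibre
end

theorem mainTheorem4 (n d : ℕ) [NeZero n] (hd : 0 < d) :
    -- the unitary group is a compact submanifold of dimension `n ^ 2`
    IsCompact (MinimalFibre.unitary n) ∧
    MinimalFibre.IsSubmanifold (MinimalFibre.unitary n) (n ^ 2) ∧
    (∀ a ∈ MinimalFibre.paramSet n,
      MinimalFibre.IsEigenfunction (MinimalFibre.unitary n) (n ^ 2) (MinimalFibre.Phi d a) ∧
      (∀ z ∈ MinimalFibre.unitary n,
        MinimalFibre.GradientNeZeroAt (MinimalFibre.unitary n) (n ^ 2)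
          (MinimalFibre.Phi d a) z) ∧
      -- submersive on an open neighbourhood of the fibre over zero
      (∃ ε : ℝ, 0 < ε ∧ ∀ z ∈ MinimalFibre.unitary n, ‖MinimalFibre.Phi d a z‖ < ε →
        MinimalFibre.IsSubmersiveAt (MinimalFibre.unitary n) (n ^ 2)
          (MinimalFibre.Phi d a) z) ∧
      (n = 1 → MinimalFibre.zeroFibre d a = ∅) ∧
      (2 ≤ n →
        (MinimalFibre.zeroFibre d a).Nonempty ∧
        IsCompact (MinimalFibre.zeroFibre d a) ∧
        MinimalFibre.IsMinimalSubmanifold (MinimalFibre.zeroFibre d a)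
          (MinimalFibre.unitary n) 2)) ∧
    -- the parameters form a non-empty open subset of `ℂⁿ` and are determined by the functions
    IsOpen (MinimalFibre.paramSet n) ∧ (MinimalFibre.paramSet n).Nonempty ∧
    (∀ a ∈ MinimalFibre.paramSet n, ∀ b ∈ MinimalFibre.paramSet n,
      (∀ z ∈ MinimalFibre.unitary n, MinimalFibre.Phi d a z = MinimalFibre.Phi d b z) →
        a = b) ∧
    -- two parameters give the same fibre exactly when they are proportional
    (2 ≤ n → ∀ a ∈ MinimalFibre.paramSet n, ∀ b ∈ MinimalFibre.paramSet n,
      (MinimalFibre.zeroFibre d a = MinimalFibre.zeroFibre d b ↔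
        ∃ c : ℂ, c ≠ 0 ∧ b = c • a)) := by
  exact ⟨MinimalFibre.isCompact_unitary n, MinimalFibre.isSubmanifold_unitary n,
    fun a ha => ⟨MinimalFibre.isEigenfunction_Phi d hd a,
      fun z _ => MinimalFibre.gradientNeZeroAt_Phi hd ha z,
      MinimalFibre.exists_isSubmersiveAt_Phi hd ha,
      fun hn => MinimalFibre.zeroFibre_eq_empty hn ha,
      fun hn => ⟨MinimalFibre.zeroFibre_nonempty hd hn ha, MinimalFibre.isCompact_zeroFibre d a,
        MinimalFibre.isMinimalSubmanifold_zeroFibre hd hn ha⟩⟩,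
    MinimalFibre.isOpen_paramSet, MinimalFibre.paramSet_nonempty,
    fun _ _ _ _ => MinimalFibre.eq_of_Phi_eq hd,
    fun _ _ ha _ hb => MinimalFibre.zeroFibre_eq_iff hd ha hb⟩
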